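/- There are numerical constants $c_0,\gamma,c_1>0$ such that the following holds for all positive integers $n,m$ with $m\ge c_0\, n\log n$. Let $a_1,\dots,a_m\in\mathbb{C}^n$ be independent random vectors, each distributed as $\mathcal N(0,I/2)+i\,\mathcal N(0,I/2)$ (real and imaginary parts independent). Let $x\in\mathbb{C}^n$ be an arbitrary fixed vector, let $y_r=|a_r^*x|^2$ for $r=1,\dots,m$, and put $\operatorname{dist}(z,x)=\min_{\phi\in[0,2\pi]}\|z-e^{i\phi}x\|$, where $\|\cdot\|$ is the Euclidean norm. (1) Initialization. With probability at least $1-10e^{-\gamma n}-8/n^2$, every eigenvector $z_0$ for the largest eigenvalue of $Y=\frac1m\sum_{r=1}^m y_r a_ra_r^*$, rescaled to have $\|z_0\|^2=\frac1m\sum_{r=1}^m y_r$, obeys $$\operatorname{dist}(z_0,x)\le\tfrac18\|x\|.\qquad(*)$$ The same holds, with the same bound on the probability, if $z_0$ is rescaled instead to have $\|z_0\|^2=n\,\sum_r y_r/\sum_r\|a_r\|^2$. (2) Convergence. For every constant step size $0<\mu\le c_1/n$ there is an event of probability at least $1-13e^{-\gamma n}-me^{-1.5m}-8/n^2$ on which,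 for every starting point $z_0\in\mathbb{C}^n$ satisfying $(*)$, the Wirtinger flow iterates $$z_{\tau+1}=z_\tau-\frac{\mu}{\|z_0\|^2}\cdot\frac1m\sum_{r=1}^m\bigl(|a_r^*z_\tau|^2-y_r\bigr)\,(a_ra_r^*)\,z_\tau$$ satisfy $$\operatorname{dist}(z_\tau,x)\le\tfrac18\Bigl(1-\frac{\mu}{4}\Bigr)^{\tau/2}\|x\|\qquad\text{for all }\tau=0,1,2,\dots$$ (If $x=0$, so that $z_0=0$, the iterates are understood to stay at $0$.) -/

import Mathlib

open MeasureTheory ProbabilityTheory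

namespace WirtingerFlow

noncomputable section

/-- The complex Gaussian law `N(0, I/2) + i N(0, I/2)` on `ℂⁿ`: the law of `u + i v`, where the
`2n` real coordinates of `u` and `v` are independent real Gaussians of mean `0`, variance `1/2`. -/
def complexGaussian (n : ℕ) : Measure (EuclideanSpace ℂ (Fin n)) :=
  ((Measure.pi fun _ : Fin n => gaussianReal 0 (1 / 2)).prod
    (Measure.pi fun _ : Fin n => gaussianReal 0 (1 / 2))).map
      fun p => WithLp.toLp 2 fun j => (p.1 j : ℂ) + (p.2 j : ℂ) * Complex.I

/-- The Gaussian model: the sampling vectors `a₁, …, aₘ` are independent random vectors, each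
distributed as `N(0, I/2) + i N(0, I/2)`. -/
structure IsGaussianModel {n m : ℕ} {Ω : Type*} [MeasurableSpace Ω] (P : Measure Ω)
    (a : Fin m → Ω → EuclideanSpace ℂ (Fin n)) : Prop where
  measurable : ∀ r, Measurable (a r)
  indep : iIndepFun a P
  law : ∀ r, P.map (a r) = complexGaussian n

/-- The quadratic samples `y_r = |a_r^* x|²` (`inner ℂ a z` is `a^* z`). -/
def samples {n m : ℕ} (a : Fin m → EuclideanSpace ℂ (Fin n)) (x : EuclideanSpace ℂ (Fin n)) :
    Fin m → ℝ :=
  fun r => ‖inner ℂ (a r) x‖ ^ 2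

/-- `dist(z, x) = min_{φ ∈ [0, 2π]} ‖z - e^{iφ} x‖` (the infimum is attained by compactness). -/
def phaseDist {n : ℕ} (z x : EuclideanSpace ℂ (Fin n)) : ℝ :=
  ⨅ φ : Set.Icc (0 : ℝ) (2 * Real.pi), ‖z - Complex.exp ((φ : ℝ) * Complex.I) • x‖

/-- The positive semidefinite Hermitian operator `Y = (1/m) ∑_r y_r a_r a_r^*` on `ℂⁿ`
(`rankOne ℂ a a` is `a a^*`). -/
def spectralOp {n m : ℕ} (a : Fin m → EuclideanSpace ℂ (Fin n)) (y : Fin m → ℝ) :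
    EuclideanSpace ℂ (Fin n) →L[ℂ] EuclideanSpace ℂ (Fin n) :=
  (1 / (m : ℂ)) • ∑ r, (y r : ℂ) • InnerProductSpace.rankOne ℂ (a r) (a r)

/-- `z₀` is an eigenvector of `Y = (1/m) ∑_r y_r a_r a_r^*` for the largest eigenvalue of `Y`,
rescaled to have Euclidean norm `s`. -/
def IsSpectralInit {n m : ℕ} (a : Fin m → EuclideanSpace ℂ (Fin n)) (y : Fin m → ℝ) (s : ℝ)
    (z₀ : EuclideanSpace ℂ (Fin n)) : Prop :=
  ∃ (t : ℝ) (v : EuclideanSpace ℂ (Fin n)),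
    IsGreatest {t' : ℝ | Module.End.HasEigenvalue
      (spectralOp a y : Module.End ℂ (EuclideanSpace ℂ (Fin n))) (t' : ℂ)} t ∧
    Module.End.HasEigenvector
      (spectralOp a y : Module.End ℂ (EuclideanSpace ℂ (Fin n))) (t : ℂ) v ∧
    ‖v‖ = 1 ∧ z₀ = (s : ℂ) • v

/-- The (Wirtinger) gradient `∇f(z) = (1/m) ∑_r (|a_r^* z|² - y_r) (a_r a_r^*) z` of
`f(z) = (1/2m) ∑_r (y_r - |a_r^* z|²)²`. -/
def grad {n m : ℕ} (a : Fin m → EuclideanSpace ℂ (Fin n)) (y : Fin m → ℝ)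
    (z : EuclideanSpace ℂ (Fin n)) : EuclideanSpace ℂ (Fin n) :=
  (1 / (m : ℂ)) • ∑ r, ((‖inner ℂ (a r) z‖ ^ 2 - y r : ℝ) : ℂ) • (inner ℂ (a r) z • a r)

/-- The Wirtinger flow iterates with learning parameters `μ₁, μ₂, …` started from `z₀`:
`z_{τ+1} = z_τ - (μ_{τ+1} / ‖z₀‖²) ∇f(z_τ)`. -/
def iterate {n m : ℕ} (a : Fin m → EuclideanSpace ℂ (Fin n)) (y : Fin m → ℝ) (μ : ℕ → ℝ)
    (z₀ : EuclideanSpace ℂ (Fin n)) : ℕ → EuclideanSpace ℂ (Fin n)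
  | 0 => z₀
  | τ + 1 => iterate a y μ z₀ τ -
      ((μ (τ + 1) / ‖z₀‖ ^ 2 : ℝ) : ℂ) • grad a y (iterate a y μ z₀ τ)

end

end WirtingerFlow

/-! The randomness enters only through `WellConditioned`, a list of seven inequalities on the
sampling vectors relative to a unit signal. On the event where they hold, initialization and
convergence are deterministic, and convergence holds for every admissible starting point at once.
Scaling reduces a nonzero signal to a unit one. For n < 10⁶ the claimed probability bounds are
negative, since γ = 10⁻⁶, and the empty event serves.

Initialization (`WellConditioned.phaseDist_smul_le`). In the mean, v^*Yv = 1 + |x^*v|² for unit v,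
which is 2 at v = x. The lower bound `fourth` at x and the upper bound `weighted` at all unit v
suffice: a leading eigenvector has v^*Yv ≥ x^*Yx, so |x^*v|² is nearly 1.

Convergence. Choose the phase of x so that h = z − x has x^*h real, and put R_r = Re(conj(a_r^*x)
a_r^*h), q_r = |a_r^*h|². Then m Re⟨h, ∇f(z)⟩ = Σ (2R_r + q_r)(R_r + q_r), and (2R + q)(R + q) =
(8/5 R + 15/16 q)² − 14/25 R² + 31/256 q². After dividing by ‖h‖², the square is at least
`curvGap`², which depends only on the direction of h; its sum is bounded below by `curvature`. The
loss in R² is paid by `weighted`. The gain in q² is kept: it absorbs the quartic part of ‖∇f‖² in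
`WellConditioned.local_smoothness`, so Σ |a_r^*h|⁴ never needs an upper bound. In that lemma the
factor n comes from |a_r^*z|² ≤ 16n for the vectors with ‖a_r‖² ≤ 8n; the others are controlled in
total by `tail`. Curvature and smoothness together make a step of order 1/n contract
(`WellConditioned.norm_sub_smul_grad_sq_le`).

Probability (`IsGaussianModel.exists_wellConditioned`). One-sided Chernoff bounds are combined with
a 10⁻⁷-net of the sphere where uniformity in w is needed. Sample size of order n is enough except
for `weighted`, whose summands are products of four Gaussians and have no exponential moments. There
|a_r^*x|² is truncated at 64 log n, which costs the logarithm in the sample size and the failure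
probability 1/n². -/

namespace WirtingerFlow

/-! ### Moments of linear functionals of the complex Gaussian vector -/

/-- The fourth moment of a centered real Gaussian is three times the squared variance. -/
lemma integral_pow_four_gaussianReal (v : NNReal) :
    ∫ t, t ^ 4 ∂(gaussianReal 0 v) = 3 * (v : ℝ) ^ 2 := by
  have h0 : (0 : ℝ) ∈ interior (integrableExpSet id (gaussianReal 0 v)) := by
    simp [integrableExpSet_id_gaussianReal]
  have h := iteratedDeriv_mgf_zero (μ := gaussianReal 0 v) (X := id) h0 4
  rw [mgf_id_gaussianReal] at h
  -- Each derivative of the moment generating function is a polynomial times the same exponential,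
  -- so one rule, applied four times, gives the fourth derivative.
  have d1 : ∀ (p q : ℝ → ℝ), (∀ t, HasDerivAt p (q t) t) →
      deriv (fun t : ℝ => p t * Real.exp (0 * t + v * t ^ 2 / 2)) =
        fun t => (q t + p t * (v * t)) * Real.exp (0 * t + v * t ^ 2 / 2) := by
    intro p q hp
    ext t
    have e : HasDerivAt (fun t : ℝ => 0 * t + v * t ^ 2 / 2) (v * t) t := by
      have := (((hasDerivAt_id t).const_mul (0 : ℝ))).add
        ((((hasDerivAt_id t).pow 2).const_mul (v : ℝ)).div_const 2)
      refine this.congr_deriv ?_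
      simp; ring
    exact (((hp t).mul e.exp).congr_deriv (by ring)).deriv
  have e0 : (fun t : ℝ => Real.exp (0 * t + v * t ^ 2 / 2)) =
      fun t => (fun _ => (1 : ℝ)) t * Real.exp (0 * t + v * t ^ 2 / 2) := by simp
  have h1 : ∀ t : ℝ, HasDerivAt (fun _ : ℝ => (1 : ℝ)) ((fun _ => 0) t) t :=
    fun t => hasDerivAt_const t 1
  have h2 : ∀ t : ℝ, HasDerivAt (fun t : ℝ => (v : ℝ) * t) ((fun _ => (v : ℝ)) t) t := fun t => by
    simpa using (hasDerivAt_id t).const_mul (v : ℝ)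
  have h3 : ∀ t : ℝ, HasDerivAt (fun t : ℝ => (v : ℝ) + v ^ 2 * t ^ 2)
      ((fun t => 2 * (v : ℝ) ^ 2 * t) t) t := fun t => by
    have := (((hasDerivAt_id t).pow 2).const_mul ((v : ℝ) ^ 2)).const_add (v : ℝ)
    refine this.congr_deriv ?_
    simp; ring
  have h4 : ∀ t : ℝ, HasDerivAt (fun t : ℝ => 3 * (v : ℝ) ^ 2 * t + v ^ 3 * t ^ 3)
      ((fun t => 3 * (v : ℝ) ^ 2 + 3 * v ^ 3 * t ^ 2) t) t := fun t => by
    have := ((hasDerivAt_id t).const_mul (3 * (v : ℝ) ^ 2)).add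
      (((hasDerivAt_id t).pow 3).const_mul ((v : ℝ) ^ 3))
    refine this.congr_deriv ?_
    simp; ring
  simp only [iteratedDeriv_succ, iteratedDeriv_zero] at h
  rw [e0, d1 _ _ h1] at h
  have e1 : (fun t : ℝ => (0 + 1 * ((v : ℝ) * t)) * Real.exp (0 * t + v * t ^ 2 / 2)) =
      fun t => (fun t => (v : ℝ) * t) t * Real.exp (0 * t + v * t ^ 2 / 2) := by
    ext; ring
  rw [e1, d1 _ _ h2] at h
  have e2 : (fun t : ℝ => ((v : ℝ) + (v : ℝ) * t * ((v : ℝ) * t)) *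
      Real.exp (0 * t + v * t ^ 2 / 2)) =
      fun t => (fun t => (v : ℝ) + v ^ 2 * t ^ 2) t * Real.exp (0 * t + v * t ^ 2 / 2) := by
    ext; ring
  rw [e2, d1 _ _ h3] at h
  have e3 : (fun t : ℝ => (2 * (v : ℝ) ^ 2 * t + ((v : ℝ) + v ^ 2 * t ^ 2) * ((v : ℝ) * t)) *
      Real.exp (0 * t + v * t ^ 2 / 2)) =
      fun t => (fun t => 3 * (v : ℝ) ^ 2 * t + v ^ 3 * t ^ 3) t *
        Real.exp (0 * t + v * t ^ 2 / 2) := by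
    ext; ring
  rw [e3, d1 _ _ h4] at h
  simpa using h.symm

/-- With variance 1/2 the density is e^{-t²}/√π, so the weight leaves e^{-t²/2}/√π, of total mass
√2. -/
lemma integrable_exp_sq_gaussianReal :
    Integrable (fun t : ℝ => Real.exp (t ^ 2 / 2)) (gaussianReal 0 (1 / 2)) ∧
      ∫ t, Real.exp (t ^ 2 / 2) ∂(gaussianReal 0 (1 / 2)) = Real.sqrt 2 := by
  have hv : (1 / 2 : NNReal) ≠ 0 := by norm_num
  have key : ∀ t : ℝ, gaussianPDFReal 0 (1 / 2) t * Real.exp (t ^ 2 / 2) =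
      (Real.sqrt Real.pi)⁻¹ * Real.exp (-(1 / 2) * t ^ 2) := by
    intro t
    rw [gaussianPDFReal, mul_assoc, ← Real.exp_add]
    congr 2
    · push_cast; congr 1; ring
    · push_cast; ring
  constructor
  · rw [gaussianReal_of_var_ne_zero _ hv]
    rw [integrable_withDensity_iff (measurable_gaussianPDF _ _)
      (ae_of_all _ fun _ => gaussianPDF_lt_top)]
    have : (fun t : ℝ => Real.exp (t ^ 2 / 2) * (gaussianPDF 0 (1 / 2) t).toReal) =
        fun t => (Real.sqrt Real.pi)⁻¹ * Real.exp (-(1 / 2) * t ^ 2) := by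
      ext t; rw [toReal_gaussianPDF, mul_comm, key]
    rw [this]
    exact (integrable_exp_neg_mul_sq (by norm_num)).const_mul _
  · rw [integral_gaussianReal_eq_integral_smul hv]
    simp_rw [smul_eq_mul, key]
    rw [integral_const_mul, integral_gaussian]
    rw [← Real.sqrt_inv, ← Real.sqrt_mul (by positivity)]
    congr 1
    field_simp

variable {n : ℕ}

lemma measurable_gaussianEmbedding : Measurable fun p : (Fin n → ℝ) × (Fin n → ℝ) =>
    (WithLp.toLp 2 fun j => (p.1 j : ℂ) + (p.2 j : ℂ) * Complex.I : EuclideanSpace ℂ (Fin n)) := by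
  apply (WithLp.measurable_toLp 2 _).comp
  fun_prop

instance : IsProbabilityMeasure (complexGaussian n) :=
  Measure.isProbabilityMeasure_map measurable_gaussianEmbedding.aemeasurable

/-- Real linear functionals of the complex Gaussian vector are real Gaussians. -/
lemma map_re_inner_complexGaussian (w : EuclideanSpace ℂ (Fin n)) :
    (complexGaussian n).map (fun b => (inner ℂ b w).re) = gaussianReal 0 (‖w‖₊ ^ 2 / 2) := by
  have hm : Measurable fun b : EuclideanSpace ℂ (Fin n) => (inner ℂ b w).re := by fun_prop
  have : IsProbabilityMeasure ((complexGaussian n).map fun b => (inner ℂ b w).re) :=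
    Measure.isProbabilityMeasure_map hm.aemeasurable
  -- The exponential of a real linear functional factors over the 2n independent real coordinates.
  apply Measure.ext_of_charFun
  ext t
  rw [charFun_gaussianReal, charFun_apply_real, integral_map hm.aemeasurable (by fun_prop),
    complexGaussian, integral_map measurable_gaussianEmbedding.aemeasurable (by fun_prop)]
  have hin : ∀ p : (Fin n → ℝ) × (Fin n → ℝ),
      Complex.exp (t * ((inner ℂ (WithLp.toLp 2 fun j =>
        (p.1 j : ℂ) + (p.2 j : ℂ) * Complex.I : EuclideanSpace ℂ (Fin n)) w).re : ℝ) * Complex.I)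
      = (∏ j, Complex.exp ((t * (w j).re : ℝ) * (p.1 j : ℝ) * Complex.I)) *
        ∏ j, Complex.exp ((t * (w j).im : ℝ) * (p.2 j : ℝ) * Complex.I) := by
    intro p
    rw [← Finset.prod_mul_distrib]
    simp_rw [← Complex.exp_add]
    rw [← Complex.exp_sum]
    congr 1
    rw [PiLp.inner_apply, Complex.re_sum, Complex.ofReal_sum, Finset.mul_sum, Finset.sum_mul]
    refine Finset.sum_congr rfl fun j _ => ?_
    simp
    ring
  simp_rw [hin]
  rw [integral_prod_mul (f := fun p : Fin n → ℝ => ∏ j, Complex.exp ((t * (w j).re : ℝ) * (p j : ℝ) * Complex.I))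
    (g := fun p : Fin n → ℝ => ∏ j, Complex.exp ((t * (w j).im : ℝ) * (p j : ℝ) * Complex.I)),
    integral_fintype_prod_eq_prod (f := fun j s => Complex.exp ((t * (w j).re : ℝ) * (s : ℝ) * Complex.I)),
    integral_fintype_prod_eq_prod (f := fun j s => Complex.exp ((t * (w j).im : ℝ) * (s : ℝ) * Complex.I))]
  simp_rw [← charFun_apply_real, charFun_gaussianReal]
  rw [← Complex.exp_sum, ← Complex.exp_sum, ← Complex.exp_add]
  congr 1
  have hw : ((‖w‖₊ ^ 2 / 2 : NNReal) : ℂ) = ∑ j, (((w j).re : ℂ) ^ 2 + ((w j).im : ℂ) ^ 2) / 2 := by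
    have : (‖w‖ : ℝ) ^ 2 = ∑ j, ((w j).re ^ 2 + (w j).im ^ 2) := by
      rw [EuclideanSpace.norm_sq_eq]
      refine Finset.sum_congr rfl fun j _ => ?_
      rw [Complex.sq_norm, Complex.normSq_apply]; ring
    push_cast
    rw [← Finset.sum_div]
    congr 1
    exact_mod_cast this
  rw [hw, ← Finset.sum_add_distrib, Finset.sum_mul, Finset.sum_div, Complex.ofReal_zero, mul_zero,
    zero_mul, zero_sub, ← Finset.sum_neg_distrib]
  refine Finset.sum_congr rfl fun j _ => ?_
  push_cast
  ring

lemma memLp_re_inner (w : EuclideanSpace ℂ (Fin n)) {p : ENNReal} (hp : p ≠ ⊤) :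
    MemLp (fun b => (inner ℂ b w).re) p (complexGaussian n) := by
  have hm : Measurable fun b : EuclideanSpace ℂ (Fin n) => (inner ℂ b w).re := by fun_prop
  have h := memLp_id_gaussianReal' (μ := 0) (v := ‖w‖₊ ^ 2 / 2) p hp
  rw [← map_re_inner_complexGaussian, memLp_map_measure_iff (by fun_prop) hm.aemeasurable] at h
  exact h

/-- Turns imaginary parts into real linear functionals, so that moments of |b^*w| follow from
`map_re_inner_complexGaussian` alone. -/
lemma im_inner_eq (b w : EuclideanSpace ℂ (Fin n)) :
    (inner ℂ b w).im = -(inner ℂ b (Complex.I • w)).re := by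
  rw [inner_smul_right]; simp

lemma memLp_norm_inner (w : EuclideanSpace ℂ (Fin n)) {p : ENNReal} (hp : p ≠ ⊤) :
    MemLp (fun b => ‖inner ℂ b w‖) p (complexGaussian n) := by
  have h := (memLp_re_inner w hp).norm.add (memLp_re_inner (Complex.I • w) hp).norm
  refine h.mono (by fun_prop) (ae_of_all _ fun b => ?_)
  have := Complex.norm_le_abs_re_add_abs_im (inner ℂ b w)
  rw [im_inner_eq, abs_neg] at this
  simpa using this.trans (le_abs_self _)

lemma integrable_norm_inner_pow (w : EuclideanSpace ℂ (Fin n)) (k : ℕ) :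
    Integrable (fun b => ‖inner ℂ b w‖ ^ k) (complexGaussian n) := by
  simpa using (memLp_norm_inner w (p := k) (by simp)).integrable_norm_pow'

lemma integrable_re_inner_pow (w : EuclideanSpace ℂ (Fin n)) (k : ℕ) :
    Integrable (fun b => (inner ℂ b w).re ^ k) (complexGaussian n) := by
  refine (memLp_re_inner w (p := k) (by simp)).integrable_norm_pow'.mono (by fun_prop)
    (ae_of_all _ fun b => ?_)
  simp

lemma integral_re_inner_sq (w : EuclideanSpace ℂ (Fin n)) :
    ∫ b, (inner ℂ b w).re ^ 2 ∂(complexGaussian n) = ‖w‖ ^ 2 / 2 := by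
  have hm : Measurable fun b : EuclideanSpace ℂ (Fin n) => (inner ℂ b w).re := by fun_prop
  have h := variance_fun_id_gaussianReal (μ := 0) (v := ‖w‖₊ ^ 2 / 2)
  rw [variance_of_integral_eq_zero (by fun_prop) integral_id_gaussianReal,
    ← map_re_inner_complexGaussian, integral_map hm.aemeasurable (by fun_prop)] at h
  simpa using h

lemma integral_re_inner_pow_four (w : EuclideanSpace ℂ (Fin n)) :
    ∫ b, (inner ℂ b w).re ^ 4 ∂(complexGaussian n) = 3 / 4 * ‖w‖ ^ 4 := by
  have hm : Measurable fun b : EuclideanSpace ℂ (Fin n) => (inner ℂ b w).re := by fun_prop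
  have h := integral_pow_four_gaussianReal (‖w‖₊ ^ 2 / 2)
  rw [← map_re_inner_complexGaussian, integral_map hm.aemeasurable (by fun_prop)] at h
  rw [h]; push_cast; ring

lemma norm_inner_sq_eq (b w : EuclideanSpace ℂ (Fin n)) :
    ‖inner ℂ b w‖ ^ 2 = (inner ℂ b w).re ^ 2 + (inner ℂ b (Complex.I • w)).re ^ 2 := by
  rw [Complex.sq_norm, Complex.normSq_apply, im_inner_eq]; ring

lemma integral_norm_inner_sq (w : EuclideanSpace ℂ (Fin n)) :
    ∫ b, ‖inner ℂ b w‖ ^ 2 ∂(complexGaussian n) = ‖w‖ ^ 2 := by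
  simp_rw [norm_inner_sq_eq]
  rw [integral_add (integrable_re_inner_pow _ 2) (integrable_re_inner_pow _ 2),
    integral_re_inner_sq, integral_re_inner_sq, norm_smul]
  simp

lemma integral_norm_inner_pow_four (w : EuclideanSpace ℂ (Fin n)) :
    ∫ b, ‖inner ℂ b w‖ ^ 4 ∂(complexGaussian n) = 2 * ‖w‖ ^ 4 := by
  -- With p, q the two real functionals, the mixed term 2p²q² is a combination of (p ± q)⁴, p⁴ and
  -- q⁴, so independence of real and imaginary parts is not needed.
  have key : ∀ b : EuclideanSpace ℂ (Fin n), ‖inner ℂ b w‖ ^ 4 =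
      1 / 6 * ((inner ℂ b (w + Complex.I • w)).re ^ 4 + (inner ℂ b (w - Complex.I • w)).re ^ 4) +
      2 / 3 * ((inner ℂ b w).re ^ 4 + (inner ℂ b (Complex.I • w)).re ^ 4) := by
    intro b
    rw [show ‖inner ℂ b w‖ ^ 4 = (‖inner ℂ b w‖ ^ 2) ^ 2 by ring, norm_inner_sq_eq,
      inner_add_right, inner_sub_right, Complex.add_re, Complex.sub_re]
    ring
  have h1 : ‖w + Complex.I • w‖ ^ 2 = 2 * ‖w‖ ^ 2 := by
    rw [norm_add_sq (𝕜 := ℂ), inner_smul_right, inner_self_eq_norm_sq_to_K, norm_smul]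
    simp [← Complex.ofReal_pow]; ring
  have h2 : ‖w - Complex.I • w‖ ^ 2 = 2 * ‖w‖ ^ 2 := by
    rw [norm_sub_sq (𝕜 := ℂ), inner_smul_right, inner_self_eq_norm_sq_to_K, norm_smul]
    simp [← Complex.ofReal_pow]; ring
  have i := fun w : EuclideanSpace ℂ (Fin n) => integrable_re_inner_pow w 4
  have ii : ∀ w w' : EuclideanSpace ℂ (Fin n), Integrable (fun b => (inner ℂ b w).re ^ 4 +
    (inner ℂ b w').re ^ 4) (complexGaussian n) := fun w w' => (i w).add (i w')
  simp_rw [key]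
  rw [integral_add ((ii _ _).const_mul _) ((ii _ _).const_mul _),
    integral_const_mul, integral_const_mul, integral_add (i _) (i _), integral_add (i _) (i _)]
  simp_rw [integral_re_inner_pow_four]
  rw [show ‖w + Complex.I • w‖ ^ 4 = (‖w + Complex.I • w‖ ^ 2) ^ 2 by ring,
    show ‖w - Complex.I • w‖ ^ 4 = (‖w - Complex.I • w‖ ^ 2) ^ 2 by ring, h1, h2, norm_smul]
  simp; ring

/-! ### Mixed fourth moments by polarization -/

lemma norm_pow_four_eq (z : ℂ) : ‖z‖ ^ 4 = (z.re ^ 2 + z.im ^ 2) ^ 2 := by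
  rw [show ‖z‖ ^ 4 = (‖z‖ ^ 2) ^ 2 by ring, Complex.sq_norm, Complex.normSq_apply]; ring

/-- Summing |u + cv|⁴ over the four phases c = ±1, ±i cancels the linear terms in c. It expresses
mixed moments of two functionals through fourth moments of single ones. -/
lemma norm_sq_mul_norm_sq_polarization (u v : ℂ) : ‖u‖ ^ 2 * ‖v‖ ^ 2 =
    1 / 16 * ((‖u + 1 * v‖ ^ 4 + ‖u + (-1) * v‖ ^ 4) +
      (‖u + Complex.I * v‖ ^ 4 + ‖u + (-Complex.I) * v‖ ^ 4)) +
    (-1 / 4) * (‖u‖ ^ 4 + ‖v‖ ^ 4) := by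
  simp only [norm_pow_four_eq, Complex.sq_norm, Complex.normSq_apply]
  simp
  ring

lemma re_conj_mul_sq_polarization (u v : ℂ) : ((starRingEnd ℂ) u * v).re ^ 2 =
    1 / 8 * (‖u + 1 * v‖ ^ 4 + ‖u + (-1) * v‖ ^ 4) +
      ((-1 / 4) * (‖u‖ ^ 4 + ‖v‖ ^ 4) + (-1 / 2) * (‖u‖ ^ 2 * ‖v‖ ^ 2)) := by
  simp only [norm_pow_four_eq, Complex.sq_norm, Complex.normSq_apply]
  simp
  ring

lemma integrable_norm_sq_mul_norm_sq (x w : EuclideanSpace ℂ (Fin n)) :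
    Integrable (fun b => ‖inner ℂ b x‖ ^ 2 * ‖inner ℂ b w‖ ^ 2) (complexGaussian n) := by
  refine ((integrable_norm_inner_pow x 4).add (integrable_norm_inner_pow w 4)).mono (by fun_prop)
    (ae_of_all _ fun b => ?_)
  simp only [Pi.add_apply]
  rw [Real.norm_of_nonneg (by positivity), Real.norm_of_nonneg (by positivity)]
  nlinarith [sq_nonneg (‖inner ℂ b x‖ ^ 2 - ‖inner ℂ b w‖ ^ 2), sq_nonneg (‖inner ℂ b x‖ ^ 2),
    sq_nonneg (‖inner ℂ b w‖ ^ 2)]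

lemma norm_add_smul_pow_four {x w : EuclideanSpace ℂ (Fin n)} (hx : ‖x‖ = 1) (hw : ‖w‖ = 1)
    {c : ℂ} (hc : ‖c‖ = 1) : ‖x + c • w‖ ^ 4 = (2 + 2 * (c * inner ℂ x w).re) ^ 2 := by
  rw [show ‖x + c • w‖ ^ 4 = (‖x + c • w‖ ^ 2) ^ 2 by ring, norm_add_sq (𝕜 := ℂ), hx, norm_smul,
    hw, hc, inner_smul_right]
  simp; ring

lemma integral_norm_sq_mul_norm_sq {x w : EuclideanSpace ℂ (Fin n)} (hx : ‖x‖ = 1)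
    (hw : ‖w‖ = 1) :
    ∫ b, ‖inner ℂ b x‖ ^ 2 * ‖inner ℂ b w‖ ^ 2 ∂(complexGaussian n) = 1 + ‖inner ℂ x w‖ ^ 2 := by
  have key : ∀ b : EuclideanSpace ℂ (Fin n), ‖inner ℂ b x‖ ^ 2 * ‖inner ℂ b w‖ ^ 2 =
      1 / 16 * ((‖inner ℂ b (x + (1 : ℂ) • w)‖ ^ 4 + ‖inner ℂ b (x + (-1 : ℂ) • w)‖ ^ 4) +
        (‖inner ℂ b (x + Complex.I • w)‖ ^ 4 + ‖inner ℂ b (x + (-Complex.I) • w)‖ ^ 4)) +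
      (-1 / 4) * (‖inner ℂ b x‖ ^ 4 + ‖inner ℂ b w‖ ^ 4) := by
    intro b
    simp only [inner_add_right, inner_smul_right]
    exact norm_sq_mul_norm_sq_polarization _ _
  have i := fun w : EuclideanSpace ℂ (Fin n) => integrable_norm_inner_pow w 4
  have ii : ∀ w w' : EuclideanSpace ℂ (Fin n), Integrable (fun b => ‖inner ℂ b w‖ ^ 4 +
    ‖inner ℂ b w'‖ ^ 4) (complexGaussian n) := fun w w' => (i w).add (i w')
  have i4 : Integrable (fun b => (‖inner ℂ b (x + (1 : ℂ) • w)‖ ^ 4 +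
      ‖inner ℂ b (x + (-1 : ℂ) • w)‖ ^ 4) + (‖inner ℂ b (x + Complex.I • w)‖ ^ 4 +
      ‖inner ℂ b (x + (-Complex.I) • w)‖ ^ 4)) (complexGaussian n) := (ii _ _).add (ii _ _)
  simp_rw [key]
  rw [integral_add (i4.const_mul _) ((ii _ _).const_mul _), integral_const_mul,
    integral_const_mul, integral_add (ii _ _) (ii _ _), integral_add (i _) (i _),
    integral_add (i _) (i _), integral_add (i _) (i _)]
  simp_rw [integral_norm_inner_pow_four]
  rw [norm_add_smul_pow_four hx hw (by simp), norm_add_smul_pow_four hx hw (by simp),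
    norm_add_smul_pow_four hx hw (by simp), norm_add_smul_pow_four hx hw (by simp), hx, hw,
    Complex.sq_norm, Complex.normSq_apply]
  simp
  ring

lemma integrable_re_conj_mul_sq (x w : EuclideanSpace ℂ (Fin n)) :
    Integrable (fun b => ((starRingEnd ℂ) (inner ℂ b x) * inner ℂ b w).re ^ 2)
      (complexGaussian n) := by
  refine (integrable_norm_sq_mul_norm_sq x w).mono (by fun_prop) (ae_of_all _ fun b => ?_)
  have := Complex.abs_re_le_norm ((starRingEnd ℂ) (inner ℂ b x) * inner ℂ b w)
  rw [norm_mul, RCLike.norm_conj] at this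
  rw [norm_pow, Real.norm_eq_abs, Real.norm_of_nonneg (by positivity), ← mul_pow]
  gcongr

lemma integral_re_conj_mul_sq {x w : EuclideanSpace ℂ (Fin n)} (hx : ‖x‖ = 1) (hw : ‖w‖ = 1) :
    ∫ b, ((starRingEnd ℂ) (inner ℂ b x) * inner ℂ b w).re ^ 2 ∂(complexGaussian n) =
      (1 + 3 * (inner ℂ x w).re ^ 2 - (inner ℂ x w).im ^ 2) / 2 := by
  have key : ∀ b : EuclideanSpace ℂ (Fin n),
      ((starRingEnd ℂ) (inner ℂ b x) * inner ℂ b w).re ^ 2 =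
      1 / 8 * (‖inner ℂ b (x + (1 : ℂ) • w)‖ ^ 4 + ‖inner ℂ b (x + (-1 : ℂ) • w)‖ ^ 4) +
      ((-1 / 4) * (‖inner ℂ b x‖ ^ 4 + ‖inner ℂ b w‖ ^ 4) +
      (-1 / 2) * (‖inner ℂ b x‖ ^ 2 * ‖inner ℂ b w‖ ^ 2)) := by
    intro b
    simp only [inner_add_right, inner_smul_right]
    exact re_conj_mul_sq_polarization _ _
  have i := fun w : EuclideanSpace ℂ (Fin n) => integrable_norm_inner_pow w 4
  have ii : ∀ w w' : EuclideanSpace ℂ (Fin n), Integrable (fun b => ‖inner ℂ b w‖ ^ 4 +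
    ‖inner ℂ b w'‖ ^ 4) (complexGaussian n) := fun w w' => (i w).add (i w')
  have j := integrable_norm_sq_mul_norm_sq x w
  have ij : Integrable (fun b => (-1 / 4) * (‖inner ℂ b x‖ ^ 4 + ‖inner ℂ b w‖ ^ 4) +
      (-1 / 2) * (‖inner ℂ b x‖ ^ 2 * ‖inner ℂ b w‖ ^ 2)) (complexGaussian n) :=
    ((ii _ _).const_mul _).add (j.const_mul _)
  simp_rw [key]
  rw [integral_add ((ii _ _).const_mul _) ij,
    integral_add ((ii _ _).const_mul _) (j.const_mul _),
    integral_const_mul, integral_const_mul, integral_const_mul,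
    integral_add (i _) (i _), integral_add (i _) (i _), integral_norm_sq_mul_norm_sq hx hw]
  simp_rw [integral_norm_inner_pow_four]
  rw [norm_add_smul_pow_four hx hw (by simp), norm_add_smul_pow_four hx hw (by simp), hx, hw,
    Complex.sq_norm, Complex.normSq_apply]
  simp
  ring

/-! ### Exponential moments -/

lemma integrable_exp_re_inner_sq {w : EuclideanSpace ℂ (Fin n)} (hw : ‖w‖ = 1) :
    Integrable (fun b => Real.exp ((inner ℂ b w).re ^ 2 / 2)) (complexGaussian n) ∧
      ∫ b, Real.exp ((inner ℂ b w).re ^ 2 / 2) ∂(complexGaussian n) = Real.sqrt 2 := by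
  have hm : Measurable fun b : EuclideanSpace ℂ (Fin n) => (inner ℂ b w).re := by fun_prop
  have hw' : ‖w‖₊ ^ 2 / 2 = (1 / 2 : NNReal) := by
    rw [show ‖w‖₊ = 1 from NNReal.eq hw]; simp
  obtain ⟨h1, h2⟩ := integrable_exp_sq_gaussianReal
  rw [← hw', ← map_re_inner_complexGaussian] at h1 h2
  rw [integrable_map_measure (by fun_prop) hm.aemeasurable] at h1
  rw [integral_map hm.aemeasurable (by fun_prop)] at h2
  exact ⟨h1, h2⟩

/-- The arithmetic–geometric mean inequality replaces independence of the real and imaginary parts.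
-/
lemma exp_norm_inner_sq_le (b w : EuclideanSpace ℂ (Fin n)) :
    Real.exp (‖inner ℂ b w‖ ^ 2 / 4) ≤ 1 / 2 * (Real.exp ((inner ℂ b w).re ^ 2 / 2) +
      Real.exp ((inner ℂ b (Complex.I • w)).re ^ 2 / 2)) := by
  have h := norm_inner_sq_eq b w
  set p := (inner ℂ b w).re ^ 2
  set q := (inner ℂ b (Complex.I • w)).re ^ 2
  have e1 : Real.exp (p / 2) = Real.exp (p / 4) ^ 2 := by rw [← Real.exp_nat_mul]; congr 1; push_cast; ring
  have e2 : Real.exp (q / 2) = Real.exp (q / 4) ^ 2 := by rw [← Real.exp_nat_mul]; congr 1; push_cast; ring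
  rw [h, add_div, Real.exp_add, e1, e2]
  nlinarith [sq_nonneg (Real.exp (p / 4) - Real.exp (q / 4))]

lemma integrable_exp_norm_inner_sq {w : EuclideanSpace ℂ (Fin n)} (hw : ‖w‖ = 1) :
    Integrable (fun b => Real.exp (‖inner ℂ b w‖ ^ 2 / 4)) (complexGaussian n) ∧
      ∫ b, Real.exp (‖inner ℂ b w‖ ^ 2 / 4) ∂(complexGaussian n) ≤ 2 := by
  have hw' : ‖Complex.I • w‖ = 1 := by rw [norm_smul, hw]; simp
  obtain ⟨h1, h2⟩ := integrable_exp_re_inner_sq hw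
  obtain ⟨k1, k2⟩ := integrable_exp_re_inner_sq hw'
  have hi : Integrable (fun b => Real.exp (‖inner ℂ b w‖ ^ 2 / 4)) (complexGaussian n) := by
    refine ((h1.add k1).const_mul (1 / 2)).mono (by fun_prop) (ae_of_all _ fun b => ?_)
    rw [Real.norm_of_nonneg (by positivity)]
    exact (exp_norm_inner_sq_le b w).trans (le_abs_self _)
  refine ⟨hi, (integral_mono hi ((h1.add k1).const_mul (1 / 2))
    fun b => exp_norm_inner_sq_le b w).trans ?_⟩
  rw [integral_const_mul]
  simp only [Pi.add_apply]
  rw [integral_add h1 k1, h2, k2]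
  have : Real.sqrt 2 ≤ 2 := Real.sqrt_le_iff.2 ⟨by norm_num, by norm_num⟩
  linarith

lemma norm_sq_eq_sum_inner (b : EuclideanSpace ℂ (Fin n)) :
    ‖b‖ ^ 2 = ∑ j, ‖inner ℂ b (EuclideanSpace.basisFun (Fin n) ℂ j)‖ ^ 2 := by
  rw [(EuclideanSpace.basisFun (Fin n) ℂ).sum_sq_norm_inner_left]

/-- The integrand factors over the 2n real coordinates, each contributing √2. -/
lemma integrable_exp_norm_sq :
    Integrable (fun b => Real.exp (‖b‖ ^ 2 / 2)) (complexGaussian n) ∧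
      ∫ b, Real.exp (‖b‖ ^ 2 / 2) ∂(complexGaussian n) = 2 ^ n := by
  obtain ⟨h1, h2⟩ := integrable_exp_sq_gaussianReal
  have hn : ∀ p : (Fin n → ℝ) × (Fin n → ℝ),
      Real.exp (‖(WithLp.toLp 2 fun j => (p.1 j : ℂ) + (p.2 j : ℂ) * Complex.I :
        EuclideanSpace ℂ (Fin n))‖ ^ 2 / 2) =
      (∏ j, Real.exp (p.1 j ^ 2 / 2)) * ∏ j, Real.exp (p.2 j ^ 2 / 2) := by
    intro p
    rw [← Real.exp_sum, ← Real.exp_sum, ← Real.exp_add, EuclideanSpace.norm_sq_eq,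
      ← Finset.sum_div, ← Finset.sum_div, ← add_div, ← Finset.sum_add_distrib]
    congr 2
    refine Finset.sum_congr rfl fun j _ => ?_
    rw [Complex.sq_norm, Complex.normSq_apply]
    simp; ring
  rw [complexGaussian, integrable_map_measure (by fun_prop)
    measurable_gaussianEmbedding.aemeasurable,
    integral_map measurable_gaussianEmbedding.aemeasurable (by fun_prop)]
  simp only [Function.comp_def]
  simp_rw [hn]
  have hi : Integrable (fun p : Fin n → ℝ => ∏ j, Real.exp (p j ^ 2 / 2))
      (Measure.pi fun _ => gaussianReal 0 (1 / 2)) :=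
    Integrable.fintype_prod fun _ => h1
  refine ⟨hi.mul_prod hi, ?_⟩
  rw [integral_prod_mul (f := fun p : Fin n → ℝ => ∏ j, Real.exp (p j ^ 2 / 2))
    (g := fun p : Fin n → ℝ => ∏ j, Real.exp (p j ^ 2 / 2)),
    integral_fintype_prod_eq_prod (f := fun _ t => Real.exp (t ^ 2 / 2)), h2]
  simp [← mul_pow]

/-! ### Chernoff bounds for sums over the sample -/

section Tails

variable {n m : ℕ} {Ω : Type*} [MeasurableSpace Ω] {P : Measure Ω}
  {a : Fin m → Ω → EuclideanSpace ℂ (Fin n)}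

lemma IsGaussianModel.integral_comp (ha : IsGaussianModel P a) (r : Fin m)
    {f : EuclideanSpace ℂ (Fin n) → ℝ} (hf : Measurable f) :
    ∫ ω, f (a r ω) ∂P = ∫ b, f b ∂(complexGaussian n) := by
  rw [← ha.law r, integral_map (ha.measurable r).aemeasurable hf.aestronglyMeasurable]

lemma IsGaussianModel.integrable_comp (ha : IsGaussianModel P a) (r : Fin m)
    {f : EuclideanSpace ℂ (Fin n) → ℝ} (hi : Integrable f (complexGaussian n)) :
    Integrable (fun ω => f (a r ω)) P := by
  rw [← ha.law r] at hi
  exact hi.comp_measurable (ha.measurable r)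

lemma IsGaussianModel.measurableSet_le_sum (ha : IsGaussianModel P a)
    {f : EuclideanSpace ℂ (Fin n) → ℝ} (hf : Measurable f) (s : ℝ) :
    MeasurableSet {ω | s ≤ ∑ r, f (a r ω)} :=
  measurableSet_le measurable_const
    (Finset.measurable_fun_sum _ fun r _ => hf.comp (ha.measurable r))

/-- Markov's inequality for sums over the sample. -/
lemma IsGaussianModel.measure_le_sum_le (ha : IsGaussianModel P a)
    {f : EuclideanSpace ℂ (Fin n) → ℝ} (hf : Measurable f) (h0 : ∀ b, 0 ≤ f b)
    (hi : Integrable f (complexGaussian n)) {s : ℝ} (hs : 0 < s) :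
    P.real {ω | s ≤ ∑ r, f (a r ω)} ≤ m * (∫ b, f b ∂(complexGaussian n)) / s := by
  rw [le_div_iff₀ hs, mul_comm]
  refine (mul_meas_ge_le_integral_of_nonneg (f := fun ω => ∑ r, f (a r ω))
    (ae_of_all _ fun ω => Finset.sum_nonneg fun r _ => h0 _)
    (integrable_finsetSum _ fun r _ => ha.integrable_comp r hi) s).trans_eq ?_
  rw [integral_finsetSum _ fun r _ => ha.integrable_comp r hi]
  simp [ha.integral_comp _ hf]

variable [IsProbabilityMeasure P]

/-- The Chernoff bound for sums over the sample. -/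
lemma IsGaussianModel.measure_le_sum_le_exp (ha : IsGaussianModel P a)
    {f : EuclideanSpace ℂ (Fin n) → ℝ} (hf : Measurable f)
    (hi : Integrable (fun b => Real.exp (f b)) (complexGaussian n)) {κ : ℝ}
    (h : ∫ b, Real.exp (f b) ∂(complexGaussian n) ≤ Real.exp κ) (s : ℝ) :
    P.real {ω | s ≤ ∑ r, f (a r ω)} ≤ Real.exp (m * κ - s) := by
  have hind : iIndepFun (fun r ω => f (a r ω)) P := ha.indep.comp (fun _ => f) fun _ => hf
  have hmeas : ∀ r, Measurable fun ω => f (a r ω) := fun r => hf.comp (ha.measurable r)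
  have hint : ∀ r ∈ Finset.univ, Integrable (fun ω => Real.exp (1 * f (a r ω))) P := fun r _ => by
    simpa using ha.integrable_comp r hi
  have hsum : Integrable (fun ω => Real.exp (1 * (∑ r, fun ω => f (a r ω)) ω)) P :=
    hind.integrable_exp_mul_sum hmeas hint
  have hb := measure_ge_le_exp_mul_mgf (μ := P) (X := ∑ r, fun ω => f (a r ω)) s zero_le_one hsum
  rw [hind.mgf_sum hmeas] at hb
  simp only [Finset.sum_apply] at hb
  refine hb.trans ?_
  have : ∏ r : Fin m, mgf (fun ω => f (a r ω)) P 1 ≤ ∏ _r : Fin m, Real.exp κ := by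
    refine Finset.prod_le_prod (fun r _ => mgf_nonneg) fun r _ => ?_
    rw [mgf]
    simp only [one_mul]
    rwa [ha.integral_comp r (f := fun b => Real.exp (f b)) hf.exp]
  rw [Finset.prod_const, Finset.card_univ, Fintype.card_fin, ← Real.exp_nat_mul] at this
  calc _ ≤ Real.exp (-1 * s) * Real.exp (m * κ) := by gcongr
    _ = _ := by rw [← Real.exp_add]; congr 1; ring

/-- Multiply e^{-t} ≥ 1 − t by (1 + t)e^t. -/
lemma exp_le_one_add_add_sq_mul_exp (t : ℝ) :
    0 ≤ t → Real.exp t ≤ 1 + t + t ^ 2 * Real.exp t := by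
  intro ht
  have h1 := Real.one_sub_le_exp_neg t
  have h2 : Real.exp t * Real.exp (-t) = 1 := by rw [← Real.exp_add]; simp
  have h3 : 0 ≤ (1 + t) * Real.exp t * (Real.exp (-t) - (1 - t)) := by
    have := Real.exp_pos t
    have : 0 ≤ Real.exp (-t) - (1 - t) := by linarith
    positivity
  have h4 : (1 + t) * Real.exp t * (Real.exp (-t) - (1 - t)) =
    (1 + t) * (Real.exp t * Real.exp (-t)) - (1 - t ^ 2) * Real.exp t := by ring
  rw [h4, h2] at h3
  linarith

/-- Since (1 − t + t²/2)(1 + t + t²/2) = 1 + t⁴/4 ≥ 1, it suffices that e^t ≥ 1 + t + t²/2. -/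
lemma exp_neg_le_one_sub_add_sq {t : ℝ} (ht : 0 ≤ t) : Real.exp (-t) ≤ 1 - t + t ^ 2 / 2 := by
  have h1 := Real.quadratic_le_exp_of_nonneg ht
  have h2 : Real.exp t * Real.exp (-t) = 1 := by rw [← Real.exp_add]; simp
  have h3 := Real.exp_pos (-t)
  have h4 : (1 + t + t ^ 2 / 2) * Real.exp (-t) ≤ 1 := by nlinarith
  have h5 : 1 ≤ (1 - t + t ^ 2 / 2) * (1 + t + t ^ 2 / 2) := by nlinarith [sq_nonneg (t ^ 2)]
  have h6 : 0 < 1 + t + t ^ 2 / 2 := by positivity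
  by_contra hc
  push Not at hc
  nlinarith

/-- Upper tail of a sum of independent nonnegative variables. -/
lemma IsGaussianModel.measure_upper_tail_le (ha : IsGaussianModel P a)
    {X : EuclideanSpace ℂ (Fin n) → ℝ} (hX : Measurable X) (h0 : ∀ b, 0 ≤ X b)
    (hi : Integrable X (complexGaussian n)) {κ : ℝ} (hκ : ∫ b, X b ∂(complexGaussian n) ≤ κ)
    {θ : ℝ} (hθ : 0 ≤ θ)
    (hi2 : Integrable (fun b => X b ^ 2 * Real.exp (θ * X b)) (complexGaussian n)) {V : ℝ}
    (hV : ∫ b, X b ^ 2 * Real.exp (θ * X b) ∂(complexGaussian n) ≤ V) (δ : ℝ) :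
    P.real {ω | m * (κ + δ) ≤ ∑ r, X (a r ω)} ≤ Real.exp (-(m * (θ * δ - θ ^ 2 * V))) := by
  rcases hθ.eq_or_lt with rfl | hθ0
  · simp
  -- The exponential stays in the quadratic remainder; this is why V bounds an exponentially
  -- weighted second moment. The lower tail, where −θX ≤ 0, needs only a plain one.
  have hle : ∀ b, Real.exp (θ * X b) ≤
      1 + θ * X b + θ ^ 2 * (X b ^ 2 * Real.exp (θ * X b)) := fun b => by
    have := exp_le_one_add_add_sq_mul_exp (θ * X b) (mul_nonneg hθ (h0 b))
    linarith [this]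
  have hi1 : Integrable (fun b => 1 + θ * X b) (complexGaussian n) :=
    (integrable_const _).add (hi.const_mul θ)
  have hi3 : Integrable (fun b => 1 + θ * X b + θ ^ 2 * (X b ^ 2 * Real.exp (θ * X b)))
      (complexGaussian n) := hi1.add (hi2.const_mul _)
  have hie : Integrable (fun b => Real.exp (θ * X b)) (complexGaussian n) := by
    refine hi3.mono (by fun_prop) (ae_of_all _ fun b => ?_)
    rw [Real.norm_of_nonneg (by positivity)]
    exact (hle b).trans (le_abs_self _)
  have hint : ∫ b, Real.exp (θ * X b) ∂(complexGaussian n) ≤ Real.exp (θ * κ + θ ^ 2 * V) := by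
    refine (integral_mono hie hi3 hle).trans ?_
    rw [integral_add hi1 (hi2.const_mul _), integral_add (integrable_const _) (hi.const_mul θ),
      integral_const_mul, integral_const_mul]
    simp only [integral_const, probReal_univ, smul_eq_mul, mul_one]
    have := Real.add_one_le_exp (θ * κ + θ ^ 2 * V)
    nlinarith [mul_le_mul_of_nonneg_left hκ hθ, mul_le_mul_of_nonneg_left hV (sq_nonneg θ)]
  have hc := ha.measure_le_sum_le_exp (hX.const_mul θ) hie hint (θ * (m * (κ + δ)))
  have hset : {ω | m * (κ + δ) ≤ ∑ r, X (a r ω)} =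
      {ω | θ * (m * (κ + δ)) ≤ ∑ r, θ * X (a r ω)} := by
    ext ω
    rw [Set.mem_ofPred_eq, Set.mem_ofPred_eq, ← Finset.mul_sum, mul_le_mul_iff_right₀ hθ0]
  rw [hset]
  refine hc.trans_eq ?_
  congr 1
  ring

/-- Lower tail of a sum of independent nonnegative variables. -/
lemma IsGaussianModel.measure_lower_tail_le (ha : IsGaussianModel P a)
    {X : EuclideanSpace ℂ (Fin n) → ℝ} (hX : Measurable X) (h0 : ∀ b, 0 ≤ X b)
    (hi : Integrable X (complexGaussian n)) {κ : ℝ} (hκ : κ ≤ ∫ b, X b ∂(complexGaussian n))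
    (hi2 : Integrable (fun b => X b ^ 2) (complexGaussian n)) {V : ℝ} (hV0 : 0 < V)
    (hV : ∫ b, X b ^ 2 ∂(complexGaussian n) ≤ V) {δ : ℝ} (hδ : 0 < δ) :
    P.real {ω | ∑ r, X (a r ω) ≤ m * (κ - δ)} ≤ Real.exp (-(m * (δ ^ 2 / (2 * V)))) := by
  -- The minimizer of θ²V/2 − θδ.
  obtain ⟨θ, hθ⟩ : ∃ θ, θ = δ / V := ⟨_, rfl⟩
  have hθ0 : 0 < θ := hθ ▸ div_pos hδ hV0
  have hle : ∀ b, Real.exp (-(θ * X b)) ≤ 1 - θ * X b + θ ^ 2 / 2 * X b ^ 2 := fun b => by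
    have := exp_neg_le_one_sub_add_sq (mul_nonneg hθ0.le (h0 b))
    linarith [this]
  have hi1 : Integrable (fun b => 1 - θ * X b) (complexGaussian n) :=
    (integrable_const _).sub (hi.const_mul θ)
  have hi3 : Integrable (fun b => 1 - θ * X b + θ ^ 2 / 2 * X b ^ 2)
      (complexGaussian n) := hi1.add (hi2.const_mul _)
  have hie : Integrable (fun b => Real.exp (-(θ * X b))) (complexGaussian n) := by
    refine hi3.mono (by fun_prop) (ae_of_all _ fun b => ?_)
    rw [Real.norm_of_nonneg (by positivity)]
    exact (hle b).trans (le_abs_self _)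
  have hint : ∫ b, Real.exp (-(θ * X b)) ∂(complexGaussian n) ≤
      Real.exp (-(θ * κ) + θ ^ 2 / 2 * V) := by
    refine (integral_mono hie hi3 hle).trans ?_
    rw [integral_add hi1 (hi2.const_mul _), integral_sub (integrable_const _) (hi.const_mul θ),
      integral_const_mul, integral_const_mul]
    simp only [integral_const, probReal_univ, smul_eq_mul, mul_one]
    have := Real.add_one_le_exp (-(θ * κ) + θ ^ 2 / 2 * V)
    nlinarith [mul_le_mul_of_nonneg_left hκ hθ0.le,
      mul_le_mul_of_nonneg_left hV (by positivity : 0 ≤ θ ^ 2 / 2)]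
  have hc := ha.measure_le_sum_le_exp (hX.const_mul θ).neg hie hint (-(θ * (m * (κ - δ))))
  have hset : {ω | ∑ r, X (a r ω) ≤ m * (κ - δ)} =
      {ω | -(θ * (m * (κ - δ))) ≤ ∑ r, -(θ * X (a r ω))} := by
    ext ω
    rw [Set.mem_ofPred_eq, Set.mem_ofPred_eq, Finset.sum_neg_distrib, ← Finset.mul_sum, neg_le_neg_iff,
      mul_le_mul_iff_right₀ hθ0]
  rw [hset]
  refine hc.trans_eq ?_
  congr 1
  rw [hθ]
  field_simp
  ring

end Tails

/-! ### Nets of the unit sphere and quadratic forms -/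

section Nets

open Metric Module

/-- Volume bound for the cardinality of separated subsets of the unit sphere. -/
lemma card_le_of_separated_unit {E : Type*} [NormedAddCommGroup E] [NormedSpace ℝ E]
    [FiniteDimensional ℝ E] {ε : ℝ} (hε : 0 < ε) (s : Finset E) (hs : ∀ c ∈ s, ‖c‖ = 1)
    (h : ∀ c ∈ s, ∀ d ∈ s, c ≠ d → ε ≤ ‖c - d‖) :
    (s.card : ℝ) ≤ (1 + 2 / ε) ^ finrank ℝ E := by
  borelize E
  let μ : Measure E := Measure.addHaar
  have hδ : 0 < ε / 2 := by positivity
  have hρ : 0 < 1 + ε / 2 := by positivity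
  have D : Set.Pairwise (s : Set E) (Function.onFun Disjoint fun c => ball (c : E) (ε / 2)) := by
    rintro c hc d hd hcd
    apply ball_disjoint_ball
    rw [dist_eq_norm]
    linarith [h c hc d hd hcd]
  have hsub : (⋃ c ∈ s, ball (c : E) (ε / 2)) ⊆ ball (0 : E) (1 + ε / 2) := by
    refine Set.iUnion₂_subset fun x hx => ball_subset_ball' ?_
    rw [dist_zero_right, hs x hx, add_comm]
  have I : (s.card : ENNReal) * ENNReal.ofReal ((ε / 2) ^ finrank ℝ E) * μ (ball 0 1) ≤
      ENNReal.ofReal ((1 + ε / 2) ^ finrank ℝ E) * μ (ball 0 1) :=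
    calc
      _ = μ (⋃ c ∈ s, ball (c : E) (ε / 2)) := by
        rw [measure_biUnion_finset D fun c _ => measurableSet_ball]
        simp only [μ.addHaar_ball_of_pos _ hδ, Finset.sum_const, nsmul_eq_mul, mul_assoc]
      _ ≤ μ (ball (0 : E) (1 + ε / 2)) := measure_mono hsub
      _ = _ := by rw [μ.addHaar_ball_of_pos _ hρ]
  have J := (ENNReal.mul_le_mul_iff_left (measure_ball_pos _ _ zero_lt_one).ne'
    measure_ball_lt_top.ne).1 I
  have K : (s.card : ℝ) * (ε / 2) ^ finrank ℝ E ≤ (1 + ε / 2) ^ finrank ℝ E := by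
    have := ENNReal.toReal_le_of_le_ofReal (pow_nonneg hρ.le _) J
    rwa [ENNReal.toReal_mul, ENNReal.toReal_natCast, ENNReal.toReal_ofReal (by positivity)] at this
  have e : 1 + ε / 2 = (1 + 2 / ε) * (ε / 2) := by field_simp; ring
  rw [e, mul_pow] at K
  exact le_of_mul_le_mul_right K (by positivity)

/-- Existence of small `ε`-nets of the unit sphere of `ℂⁿ`. -/
lemma exists_net_unit_sphere (n : ℕ) {ε : ℝ} (hε : 0 < ε) :
    ∃ N : Finset (EuclideanSpace ℂ (Fin n)), (∀ c ∈ N, ‖c‖ = 1) ∧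
      (N.card : ℝ) ≤ ((1 + 2 / ε) ^ 2) ^ n ∧ ∀ w, ‖w‖ = 1 → ∃ c ∈ N, ‖w - c‖ ≤ ε := by
  classical
  have hfin : finrank ℝ (EuclideanSpace ℂ (Fin n)) = 2 * n := by
    rw [← finrank_mul_finrank ℝ ℂ (EuclideanSpace ℂ (Fin n)), Complex.finrank_real_complex,
      finrank_euclideanSpace_fin]
  let S : Set ℕ := {k | ∃ N : Finset (EuclideanSpace ℂ (Fin n)), (∀ c ∈ N, ‖c‖ = 1) ∧
    (∀ c ∈ N, ∀ d ∈ N, c ≠ d → ε ≤ ‖c - d‖) ∧ N.card = k}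
  have hcard : ∀ N : Finset (EuclideanSpace ℂ (Fin n)), (∀ c ∈ N, ‖c‖ = 1) →
      (∀ c ∈ N, ∀ d ∈ N, c ≠ d → ε ≤ ‖c - d‖) → (N.card : ℝ) ≤ ((1 + 2 / ε) ^ 2) ^ n := by
    intro N h1 h2
    have := card_le_of_separated_unit hε N h1 h2
    rwa [hfin, pow_mul] at this
  have hbdd : BddAbove S := by
    refine ⟨⌊((1 + 2 / ε) ^ 2) ^ n⌋₊, ?_⟩
    rintro k ⟨N, h1, h2, rfl⟩
    exact Nat.le_floor (hcard N h1 h2)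
  have hne : S.Nonempty := ⟨0, ∅, by simp⟩
  -- A separated set of maximal cardinality is a net: a unit vector farther than ε from all its
  -- points could be added to it.
  obtain ⟨N, h1, h2, h3⟩ := Nat.sSup_mem hne hbdd
  refine ⟨N, h1, hcard N h1 h2, fun w hw => ?_⟩
  by_contra! hcon
  have hwN : w ∉ N := fun hN => by
    have := hcon w hN
    simp at this
    linarith
  have : N.card + 1 ∈ S := by
    refine ⟨insert w N, ?_, ?_, Finset.card_insert_of_notMem hwN⟩
    · intro c hc
      rcases Finset.mem_insert.1 hc with rfl | hc
      exacts [hw, h1 c hc]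
    · intro c hc d hd hcd
      rcases Finset.mem_insert.1 hc with rfl | hc' <;> rcases Finset.mem_insert.1 hd with rfl | hd'
      · exact absurd rfl hcd
      · exact (hcon d hd').le
      · rw [norm_sub_rev]; exact (hcon c hc').le
      · exact h2 c hc' d hd' hcd
  have := le_csSup hbdd this
  omega

variable {n m : ℕ}

/-- Young's inequality (p + q)² ≤ (1 + ε)p² + (1 + 1/ε)q². The factor near 1 at c keeps sharp
constants when passing from a net to the sphere. -/
lemma sum_weighted_norm_inner_sq_le_add (b : Fin m → EuclideanSpace ℂ (Fin n)) {γ : Fin m → ℝ}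
    (hγ : ∀ r, 0 ≤ γ r) {ε : ℝ} (hε : 0 < ε) (w c : EuclideanSpace ℂ (Fin n)) :
    ∑ r, γ r * ‖inner ℂ (b r) w‖ ^ 2 ≤ (1 + ε) * ∑ r, γ r * ‖inner ℂ (b r) c‖ ^ 2 +
      (1 + 1 / ε) * ∑ r, γ r * ‖inner ℂ (b r) (w - c)‖ ^ 2 := by
  rw [Finset.mul_sum, Finset.mul_sum, ← Finset.sum_add_distrib]
  refine Finset.sum_le_sum fun r _ => ?_
  have h1 : ‖inner ℂ (b r) w‖ ≤ ‖inner ℂ (b r) c‖ + ‖inner ℂ (b r) (w - c)‖ := by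
    have := norm_add_le (inner ℂ (b r) c) (inner ℂ (b r) (w - c))
    rwa [← inner_add_right, add_sub_cancel] at this
  have h2 : ‖inner ℂ (b r) w‖ ^ 2 ≤ (1 + ε) * ‖inner ℂ (b r) c‖ ^ 2 +
      (1 + 1 / ε) * ‖inner ℂ (b r) (w - c)‖ ^ 2 := by
    set p := ‖inner ℂ (b r) c‖
    set q := ‖inner ℂ (b r) (w - c)‖
    have h3 : (p + q) ^ 2 ≤ (1 + ε) * p ^ 2 + (1 + 1 / ε) * q ^ 2 := by
      have : (1 + ε) * p ^ 2 + (1 + 1 / ε) * q ^ 2 - (p + q) ^ 2 = (ε * p - q) ^ 2 / ε := by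
        field_simp; ring
      have : 0 ≤ (ε * p - q) ^ 2 / ε := by positivity
      linarith
    have : ‖inner ℂ (b r) w‖ ^ 2 ≤ (p + q) ^ 2 := by gcongr
    linarith
  calc _ ≤ γ r * ((1 + ε) * ‖inner ℂ (b r) c‖ ^ 2 +
      (1 + 1 / ε) * ‖inner ℂ (b r) (w - c)‖ ^ 2) := mul_le_mul_of_nonneg_left h2 (hγ r)
    _ = _ := by ring

lemma sum_weighted_norm_inner_sq_smul (b : Fin m → EuclideanSpace ℂ (Fin n)) (γ : Fin m → ℝ)
    (c : ℂ) (w : EuclideanSpace ℂ (Fin n)) :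
    ∑ r, γ r * ‖inner ℂ (b r) (c • w)‖ ^ 2 =
      ‖c‖ ^ 2 * ∑ r, γ r * ‖inner ℂ (b r) w‖ ^ 2 := by
  rw [Finset.mul_sum]
  refine Finset.sum_congr rfl fun r _ => ?_
  rw [inner_smul_right, norm_mul]; ring

/-- A bound of a quadratic form on the unit sphere extends to the whole space. -/
lemma sum_weighted_norm_inner_sq_le_of_unit (b : Fin m → EuclideanSpace ℂ (Fin n))
    {γ : Fin m → ℝ} {M : ℝ}
    (h : ∀ w, ‖w‖ = 1 → ∑ r, γ r * ‖inner ℂ (b r) w‖ ^ 2 ≤ M) (w : EuclideanSpace ℂ (Fin n)) :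
    ∑ r, γ r * ‖inner ℂ (b r) w‖ ^ 2 ≤ M * ‖w‖ ^ 2 := by
  by_cases hw : w = 0
  · simp [hw]
  have hw' : ‖w‖ ≠ 0 := norm_ne_zero_iff.2 hw
  have e : w = (‖w‖ : ℂ) • ((‖w‖⁻¹ : ℝ) : ℂ) • w := by
    rw [smul_smul, ← Complex.ofReal_mul, mul_inv_cancel₀ hw']; simp
  have hu : ‖((‖w‖⁻¹ : ℝ) : ℂ) • w‖ = 1 := by
    rw [norm_smul, Complex.norm_real, norm_inv, norm_norm, inv_mul_cancel₀ hw']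
  have := h _ hu
  rw [e, sum_weighted_norm_inner_sq_smul, ← e, Complex.norm_real, norm_norm, mul_comm]
  gcongr

/-- A bound of a positive semidefinite quadratic form on an `ε`-net extends to the sphere. -/
lemma sum_weighted_norm_inner_sq_le_of_net (b : Fin m → EuclideanSpace ℂ (Fin n))
    {γ : Fin m → ℝ} (hγ : ∀ r, 0 ≤ γ r) {ε : ℝ} (hε : 0 < ε) (hε1 : ε ≤ 1 / 4)
    {N : Finset (EuclideanSpace ℂ (Fin n))}
    (hN : ∀ w, ‖w‖ = 1 → ∃ c ∈ N, ‖w - c‖ ≤ ε) {M : ℝ}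
    (hM : ∀ c ∈ N, ∑ r, γ r * ‖inner ℂ (b r) c‖ ^ 2 ≤ M) (w : EuclideanSpace ℂ (Fin n)) :
    ∑ r, γ r * ‖inner ℂ (b r) w‖ ^ 2 ≤ (1 + 4 * ε) * M * ‖w‖ ^ 2 := by
  refine sum_weighted_norm_inner_sq_le_of_unit b ?_ w
  clear w
  intro w hw
  have hc : ContinuousOn (fun w : EuclideanSpace ℂ (Fin n) =>
      ∑ r, γ r * ‖inner ℂ (b r) w‖ ^ 2) (sphere 0 1) := by fun_prop
  -- At a maximizer the error term, the form at w₀ − c, is at most ε² times the maximum Q itself, so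
  -- Q ≤ (1 + ε)M + (ε + ε²)Q can be solved for Q.
  obtain ⟨w₀, hw₀, hmax⟩ := (isCompact_sphere (0 : EuclideanSpace ℂ (Fin n)) 1).exists_isMaxOn
    ⟨w, by simpa using hw⟩ hc
  have hw₀' : ‖w₀‖ = 1 := by simpa using hw₀
  refine (hmax (show w ∈ sphere 0 1 by simpa using hw)).trans ?_
  obtain ⟨c, hcN, hcw⟩ := hN w₀ hw₀'
  have h1 := sum_weighted_norm_inner_sq_le_add b hγ hε w₀ c
  have h2 := sum_weighted_norm_inner_sq_le_of_unit b (fun v hv =>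
    hmax (show v ∈ sphere 0 1 by simpa using hv)) (w₀ - c)
  have h3 := hM c hcN
  set Q := ∑ r, γ r * ‖inner ℂ (b r) w₀‖ ^ 2
  have hQ : 0 ≤ Q := Finset.sum_nonneg fun r _ => mul_nonneg (hγ r) (by positivity)
  have hM0 : 0 ≤ M := le_trans (Finset.sum_nonneg fun r _ => mul_nonneg (hγ r) (by positivity)) h3
  have h4 : ∑ r, γ r * ‖inner ℂ (b r) (w₀ - c)‖ ^ 2 ≤ Q * ε ^ 2 := by
    refine h2.trans ?_
    gcongr
  have h5 : Q ≤ (1 + ε) * M + (ε + ε ^ 2) * Q := by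
    calc Q ≤ (1 + ε) * M + (1 + 1 / ε) * (Q * ε ^ 2) := by
          refine h1.trans ?_
          gcongr
      _ = _ := by field_simp; ring
  have h6 : Q * (1 - ε - ε ^ 2) ≤ (1 + ε) * M := by linarith
  have h8 : (1 + ε) * M ≤ (1 + 4 * ε) * M * (1 - ε - ε ^ 2) := by
    have h7 : 0 ≤ M * ε * (2 - 5 * ε - 4 * ε ^ 2) := by
      have : 0 ≤ 2 - 5 * ε - 4 * ε ^ 2 := by nlinarith
      positivity
    linarith
  have h9 : 0 < 1 - ε - ε ^ 2 := by nlinarith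
  exact le_of_mul_le_mul_right (h6.trans h8) h9

end Nets

/-! ### The deterministic conditions and the moments behind them -/

section GoodEvent

variable {n m : ℕ}

/-- The correlation `Re (conj (b^* x) (b^* w))` of the measurements of `x` and `w`. -/
noncomputable def correl (b x w : EuclideanSpace ℂ (Fin n)) : ℝ :=
  ((starRingEnd ℂ) (inner ℂ b x) * inner ℂ b w).re

/-- A lower bound for `|8/5 R + 15/16 t |b^* w|²|`, `R = correl b x w`, uniform in `t ∈ [0, 1/8]`. -/
noncomputable def curvGap (b x w : EuclideanSpace ℂ (Fin n)) : ℝ :=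
  max 0 (8 / 5 * |correl b x w| - 15 / 128 * ‖inner ℂ b w‖ ^ 2)

/-- The deterministic conditions on the sampling vectors under which spectral initialization and
Wirtinger flow succeed for the unit vector `x`. -/
structure WellConditioned (b : Fin m → EuclideanSpace ℂ (Fin n)) (x : EuclideanSpace ℂ (Fin n)) :
    Prop where
  upper : ∀ w, ∑ r, ‖inner ℂ (b r) w‖ ^ 2 ≤ 1001 / 1000 * m * ‖w‖ ^ 2
  weighted : ∀ w, ‖w‖ = 1 → ∑ r, ‖inner ℂ (b r) x‖ ^ 2 * ‖inner ℂ (b r) w‖ ^ 2 ≤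
    m * (1001 / 1000 + ‖inner ℂ x w‖ ^ 2)
  fourth : m * (1999 / 1000) ≤ ∑ r, ‖inner ℂ (b r) x‖ ^ 4
  second : m * (999 / 1000) ≤ ∑ r, ‖inner ℂ (b r) x‖ ^ 2
  energy : m * (999 / 1000 * n) ≤ ∑ r, ‖b r‖ ^ 2
  curvature : ∀ w, ‖w‖ = 1 → (inner ℂ x w).im = 0 →
    m * (4 / 5 + 3 / 5 * (inner ℂ x w).re ^ 2) ≤ ∑ r, curvGap (b r) x w ^ 2
  tail : ∑ r, (if 8 * n < ‖b r‖ ^ 2 then ‖b r‖ ^ 6 else 0) ≤ m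

lemma pow_le_factorial_mul_exp {t : ℝ} (ht : 0 ≤ t) (k : ℕ) :
    t ^ k ≤ k.factorial * Real.exp t := by
  have := Real.pow_div_factorial_le_exp t ht k
  rwa [div_le_iff₀ (by positivity), mul_comm] at this

lemma abs_correl_le (b x w : EuclideanSpace ℂ (Fin n)) :
    |correl b x w| ≤ ‖inner ℂ b x‖ * ‖inner ℂ b w‖ := by
  have := Complex.abs_re_le_norm ((starRingEnd ℂ) (inner ℂ b x) * inner ℂ b w)
  rwa [norm_mul, RCLike.norm_conj] at this

lemma correl_sq_le (b x w : EuclideanSpace ℂ (Fin n)) :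
    correl b x w ^ 2 ≤ ‖inner ℂ b x‖ ^ 2 * ‖inner ℂ b w‖ ^ 2 := by
  rw [← sq_abs, ← mul_pow]
  gcongr
  exact abs_correl_le b x w

lemma curvGap_nonneg (b x w : EuclideanSpace ℂ (Fin n)) : 0 ≤ curvGap b x w := le_max_left _ _

@[fun_prop]
lemma measurable_correl (x w : EuclideanSpace ℂ (Fin n)) : Measurable fun b => correl b x w := by
  unfold correl; fun_prop

@[fun_prop]
lemma measurable_curvGap (x w : EuclideanSpace ℂ (Fin n)) : Measurable fun b => curvGap b x w := by
  unfold curvGap; fun_prop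

lemma curvGap_pow_four_le (b x w : EuclideanSpace ℂ (Fin n)) :
    curvGap b x w ^ 4 ≤ 33 / 10 * (‖inner ℂ b x‖ ^ 8 + ‖inner ℂ b w‖ ^ 8) := by
  have h1 : curvGap b x w ≤ 8 / 5 * (‖inner ℂ b x‖ * ‖inner ℂ b w‖) := by
    refine max_le (by positivity) ?_
    have := abs_correl_le b x w
    have : 0 ≤ ‖inner ℂ b w‖ ^ 2 := by positivity
    linarith
  calc curvGap b x w ^ 4 ≤ (8 / 5 * (‖inner ℂ b x‖ * ‖inner ℂ b w‖)) ^ 4 := by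
        gcongr
        exact curvGap_nonneg b x w
    _ ≤ _ := by
      nlinarith [sq_nonneg (‖inner ℂ b x‖ ^ 4 - ‖inner ℂ b w‖ ^ 4), sq_nonneg (‖inner ℂ b x‖ ^ 4),
        sq_nonneg (‖inner ℂ b w‖ ^ 4)]

/-- With p = |R| and q = |b^*w|², the bound on the cross term is exact up to the square (3/32)(2p −
q)². The result has a computable mean. -/
lemma le_curvGap_sq (b x w : EuclideanSpace ℂ (Fin n)) :
    2185 / 1000 * correl b x w ^ 2 - 9375 / 100000 * ‖inner ℂ b w‖ ^ 4 ≤ curvGap b x w ^ 2 := by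
  unfold curvGap
  rw [← sq_abs (correl b x w)]
  set p := |correl b x w|
  have hp : 0 ≤ p := abs_nonneg _
  set q := ‖inner ℂ b w‖ ^ 2 with hq
  rw [show ‖inner ℂ b w‖ ^ 4 = q ^ 2 by rw [hq]; ring]
  have hq0 : 0 ≤ q := by positivity
  rcases le_total 0 (8 / 5 * p - 15 / 128 * q) with h | h
  · rw [max_eq_right h]
    nlinarith [sq_nonneg (2 * p - q), sq_nonneg q]
  · rw [max_eq_left h]
    nlinarith [sq_nonneg (2 * p - q), sq_nonneg q]

lemma integral_norm_inner_pow_eight_le {w : EuclideanSpace ℂ (Fin n)} (hw : ‖w‖ = 1) :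
    ∫ b, ‖inner ℂ b w‖ ^ 8 ∂(complexGaussian n) ≤ 12288 := by
  obtain ⟨h1, h2⟩ := integrable_exp_norm_inner_sq hw
  refine (integral_mono (integrable_norm_inner_pow w 8) (h1.const_mul 6144) fun b => ?_).trans ?_
  · have := pow_le_factorial_mul_exp (t := ‖inner ℂ b w‖ ^ 2 / 4) (by positivity) 4
    simp only [Nat.factorial] at this
    norm_num at this
    have e : (‖inner ℂ b w‖ ^ 2 / 4) ^ 4 = ‖inner ℂ b w‖ ^ 8 / 256 := by ring
    rw [e] at this
    show _ ≤ 6144 * Real.exp (‖inner ℂ b w‖ ^ 2 / 4)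
    linarith
  · rw [integral_const_mul]; linarith

lemma integrable_curvGap_pow_four (x w : EuclideanSpace ℂ (Fin n)) :
    Integrable (fun b => curvGap b x w ^ 4) (complexGaussian n) := by
  refine (((integrable_norm_inner_pow x 8).add (integrable_norm_inner_pow w 8)).const_mul
    (33 / 10)).mono (by fun_prop) (ae_of_all _ fun b => ?_)
  rw [Real.norm_of_nonneg (by positivity)]
  exact (curvGap_pow_four_le b x w).trans (le_abs_self _)

lemma integral_curvGap_pow_four_le {x w : EuclideanSpace ℂ (Fin n)} (hx : ‖x‖ = 1)
    (hw : ‖w‖ = 1) : ∫ b, curvGap b x w ^ 4 ∂(complexGaussian n) ≤ 82000 := by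
  have i1 := integrable_norm_inner_pow x 8
  have i2 := integrable_norm_inner_pow w 8
  refine (integral_mono (integrable_curvGap_pow_four x w) ((i1.add i2).const_mul (33 / 10))
    fun b => curvGap_pow_four_le b x w).trans ?_
  rw [integral_const_mul]
  simp only [Pi.add_apply]
  rw [integral_add i1 i2]
  linarith [integral_norm_inner_pow_eight_le hx, integral_norm_inner_pow_eight_le hw]

/-- Truncation at K costs at most p⁴/K², which a fourth moment makes small in the mean. -/
lemma sq_sub_le_min_sq {p : ℝ} {K : ℝ} (hK : 0 < K) :
    p ^ 2 - p ^ 4 / K ^ 2 ≤ min p K ^ 2 := by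
  rcases le_total p K with h | h
  · rw [min_eq_left h]
    have : 0 ≤ p ^ 4 / K ^ 2 := by positivity
    linarith
  · rw [min_eq_right h, sub_le_iff_le_add, ← sub_le_iff_le_add', le_div_iff₀ (by positivity)]
    nlinarith [sq_nonneg (p ^ 2 - K ^ 2), sq_nonneg (p ^ 2), sq_nonneg (K ^ 2)]

/-- The truncated squared curvature gap has a large mean. -/
lemma le_integral_min_curvGap_sq {x w : EuclideanSpace ℂ (Fin n)} (hx : ‖x‖ = 1)
    (hw : ‖w‖ = 1) :
    Integrable (fun b => min (curvGap b x w) 10000 ^ 2) (complexGaussian n) ∧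
    9 / 10 + 3 * (inner ℂ x w).re ^ 2 - 2 * (inner ℂ x w).im ^ 2 ≤
      ∫ b, min (curvGap b x w) 10000 ^ 2 ∂(complexGaussian n) := by
  have hi : Integrable (fun b => min (curvGap b x w) 10000 ^ 2) (complexGaussian n) := by
    refine Integrable.of_bound (C := 10000 ^ 2) (by fun_prop) (ae_of_all _ fun b => ?_)
    have h0 : 0 ≤ min (curvGap b x w) 10000 := le_min (curvGap_nonneg b x w) (by norm_num)
    rw [Real.norm_of_nonneg (by positivity)]
    gcongr
    exact min_le_right _ _
  refine ⟨hi, ?_⟩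
  have i1 := (integrable_re_conj_mul_sq x w).const_mul (2185 / 1000)
  have i2 := (integrable_norm_inner_pow w 4).const_mul (9375 / 100000)
  have i3 := (integrable_curvGap_pow_four x w).const_mul (1 / 10000 ^ 2)
  have i12 : Integrable (fun b => 2185 / 1000 *
      ((starRingEnd ℂ) (inner ℂ b x) * inner ℂ b w).re ^ 2 -
        9375 / 100000 * ‖inner ℂ b w‖ ^ 4) (complexGaussian n) := i1.sub i2
  have h := integral_mono (i12.sub i3) hi fun b => by
    have h1 := le_curvGap_sq b x w
    have h2 := sq_sub_le_min_sq (p := curvGap b x w) (K := 10000) (by norm_num)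
    have h3 : 2185 / 1000 * correl b x w ^ 2 - 9375 / 100000 * ‖inner ℂ b w‖ ^ 4 -
      1 / 10000 ^ 2 * curvGap b x w ^ 4 ≤ min (curvGap b x w) 10000 ^ 2 := by linarith
    exact h3
  refine le_trans ?_ h
  simp only [Pi.sub_apply]
  rw [integral_sub i12 i3, integral_sub i1 i2, integral_const_mul, integral_const_mul,
    integral_const_mul, integral_re_conj_mul_sq hx hw, integral_norm_inner_pow_four, hw]
  -- The constant 2.185/2 − 2·0.09375 − 82000/10⁸ exceeds 9/10; the coefficients of Re² and Im² are
  -- 3.2775 and −1.0925.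
  have := integral_curvGap_pow_four_le hx hw
  nlinarith [sq_nonneg (inner ℂ x w).re, sq_nonneg (inner ℂ x w).im]

lemma integral_norm_sq : Integrable (fun b => ‖b‖ ^ 2) (complexGaussian n) ∧
    ∫ b, ‖b‖ ^ 2 ∂(complexGaussian n) = n := by
  simp_rw [norm_sq_eq_sum_inner]
  refine ⟨integrable_finsetSum _ fun j _ => integrable_norm_inner_pow _ 2, ?_⟩
  rw [integral_finsetSum _ fun j _ => integrable_norm_inner_pow _ 2]
  simp_rw [integral_norm_inner_sq]
  simp

lemma integral_norm_pow_four_le : Integrable (fun b => (‖b‖ ^ 2) ^ 2) (complexGaussian n) ∧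
    ∫ b, (‖b‖ ^ 2) ^ 2 ∂(complexGaussian n) ≤ 2 * n ^ 2 := by
  have hle : ∀ b : EuclideanSpace ℂ (Fin n), (‖b‖ ^ 2) ^ 2 ≤
      n * ∑ j, ‖inner ℂ b (EuclideanSpace.basisFun (Fin n) ℂ j)‖ ^ 4 := fun b => by
    rw [norm_sq_eq_sum_inner]
    refine (sq_sum_le_card_mul_sum_sq (s := Finset.univ)).trans_eq ?_
    simp only [Finset.card_univ, Fintype.card_fin]
    congr 1
    exact Finset.sum_congr rfl fun j _ => by ring
  have hi : Integrable (fun b => (n : ℝ) *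
      ∑ j, ‖inner ℂ b (EuclideanSpace.basisFun (Fin n) ℂ j)‖ ^ 4) (complexGaussian n) :=
    (integrable_finsetSum _ fun j _ => integrable_norm_inner_pow _ 4).const_mul _
  have hi2 : Integrable (fun b => (‖b‖ ^ 2) ^ 2) (complexGaussian n) := by
    refine hi.mono (by fun_prop) (ae_of_all _ fun b => ?_)
    rw [Real.norm_of_nonneg (by positivity)]
    exact (hle b).trans (le_abs_self _)
  refine ⟨hi2, (integral_mono hi2 hi hle).trans_eq ?_⟩
  rw [integral_const_mul, integral_finsetSum _ fun j _ => integrable_norm_inner_pow _ 4]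
  simp_rw [integral_norm_inner_pow_four]
  simp
  ring

/-- Beyond the threshold e^{‖b‖²/4} ≤ e^{-2n} e^{‖b‖²/2}. The factor e^{-2n} outweighs the mean 2^n
of the last exponential. -/
lemma tail_le (b : EuclideanSpace ℂ (Fin n)) :
    (if 8 * n < ‖b‖ ^ 2 then ‖b‖ ^ 6 else 0) ≤
      384 * Real.exp (-(2 * n)) * Real.exp (‖b‖ ^ 2 / 2) := by
  split_ifs with h
  · have h1 := pow_le_factorial_mul_exp (t := ‖b‖ ^ 2 / 4) (by positivity) 3
    simp only [Nat.factorial] at h1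
    norm_num at h1
    have e : (‖b‖ ^ 2 / 4) ^ 3 = ‖b‖ ^ 6 / 64 := by ring
    rw [e] at h1
    have h2 : Real.exp (‖b‖ ^ 2 / 4) ≤ Real.exp (-(2 * n)) * Real.exp (‖b‖ ^ 2 / 2) := by
      rw [← Real.exp_add]
      apply Real.exp_le_exp.2
      linarith
    linarith
  · positivity

lemma measurable_tail :
    Measurable fun b : EuclideanSpace ℂ (Fin n) => if 8 * n < ‖b‖ ^ 2 then ‖b‖ ^ 6 else 0 :=
  Measurable.ite (measurableSet_lt measurable_const (by fun_prop)) (by fun_prop) measurable_const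

lemma integral_tail_le : Integrable (fun b : EuclideanSpace ℂ (Fin n) =>
      if 8 * n < ‖b‖ ^ 2 then ‖b‖ ^ 6 else 0) (complexGaussian n) ∧
    ∫ b, (if 8 * n < ‖b‖ ^ 2 then ‖b‖ ^ 6 else 0) ∂(complexGaussian n) ≤
      384 * Real.exp (-(2 * n)) * 2 ^ n := by
  obtain ⟨h1, h2⟩ := integrable_exp_norm_sq (n := n)
  have hi := h1.const_mul (384 * Real.exp (-(2 * n)))
  have hi2 : Integrable (fun b : EuclideanSpace ℂ (Fin n) =>
      if 8 * n < ‖b‖ ^ 2 then ‖b‖ ^ 6 else 0) (complexGaussian n) := by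
    refine hi.mono measurable_tail.aestronglyMeasurable (ae_of_all _ fun b => ?_)
    rw [Real.norm_of_nonneg (by split_ifs <;> positivity)]
    exact (tail_le b).trans (le_abs_self _)
  refine ⟨hi2, (integral_mono hi2 hi tail_le).trans_eq ?_⟩
  rw [integral_const_mul, h2]

lemma measurable_largeSample (x : EuclideanSpace ℂ (Fin n)) (T : ℝ) : Measurable fun b =>
    if T < ‖inner ℂ b x‖ ^ 2 then ‖inner ℂ b x‖ ^ 2 * ‖b‖ ^ 2 else 0 :=
  Measurable.ite (measurableSet_lt measurable_const (by fun_prop)) (by fun_prop) measurable_const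

/-- Large samples contribute little to the weighted energy. -/
lemma integral_largeSample_le {x : EuclideanSpace ℂ (Fin n)} (hx : ‖x‖ = 1) (T : ℝ) :
    Integrable (fun b => if T < ‖inner ℂ b x‖ ^ 2 then ‖inner ℂ b x‖ ^ 2 * ‖b‖ ^ 2 else 0)
      (complexGaussian n) ∧
    ∫ b, (if T < ‖inner ℂ b x‖ ^ 2 then ‖inner ℂ b x‖ ^ 2 * ‖b‖ ^ 2 else 0)
      ∂(complexGaussian n) ≤ 256 * n * Real.exp (-(T / 16)) := by
  have hle : ∀ b : EuclideanSpace ℂ (Fin n),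
      (if T < ‖inner ℂ b x‖ ^ 2 then ‖inner ℂ b x‖ ^ 2 * ‖b‖ ^ 2 else 0) ≤
      64 * Real.exp (-(T / 16)) * ∑ j, (Real.exp (‖inner ℂ b x‖ ^ 2 / 4) +
        Real.exp (‖inner ℂ b (EuclideanSpace.basisFun (Fin n) ℂ j)‖ ^ 2 / 4)) := fun b => by
    split_ifs with h
    · rw [norm_sq_eq_sum_inner b, Finset.mul_sum, Finset.mul_sum]
      refine Finset.sum_le_sum fun j _ => ?_
      set p := ‖inner ℂ b x‖ ^ 2
      set q := ‖inner ℂ b (EuclideanSpace.basisFun (Fin n) ℂ j)‖ ^ 2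
      have hp : 0 ≤ p := by positivity
      have hq : 0 ≤ q := by positivity
      -- Half of the exponent p/8 pays for the factor e^{-T/16}. The remaining e^{p/8} e^{q/8} is
      -- split into e^{p/4} and e^{q/4}, so x and the basis vectors need not be independent
      -- directions.
      have h1 : p ≤ 16 * (Real.exp (-(T / 16)) * Real.exp (p / 8)) := by
        have : p / 16 ≤ Real.exp (p / 16) := by linarith [Real.add_one_le_exp (p / 16)]
        have h2 : Real.exp (p / 16) ≤ Real.exp (-(T / 16)) * Real.exp (p / 8) := by
          rw [← Real.exp_add]
          exact Real.exp_le_exp.2 (by linarith)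
        linarith
      have h3 : q ≤ 8 * Real.exp (q / 8) := by linarith [Real.add_one_le_exp (q / 8)]
      have e1 : Real.exp (p / 4) = Real.exp (p / 8) ^ 2 := by
        rw [← Real.exp_nat_mul]; congr 1; push_cast; ring
      have e2 : Real.exp (q / 4) = Real.exp (q / 8) ^ 2 := by
        rw [← Real.exp_nat_mul]; congr 1; push_cast; ring
      rw [e1, e2]
      have h4 : 2 * (Real.exp (p / 8) * Real.exp (q / 8)) ≤
          Real.exp (p / 8) ^ 2 + Real.exp (q / 8) ^ 2 := by
        nlinarith [sq_nonneg (Real.exp (p / 8) - Real.exp (q / 8))]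
      calc p * q ≤ (16 * (Real.exp (-(T / 16)) * Real.exp (p / 8))) * (8 * Real.exp (q / 8)) := by
            gcongr
        _ = 64 * Real.exp (-(T / 16)) * (2 * (Real.exp (p / 8) * Real.exp (q / 8))) := by ring
        _ ≤ _ := by gcongr
    · exact mul_nonneg (by positivity) (Finset.sum_nonneg fun j _ => by positivity)
  have h1 := integrable_exp_norm_inner_sq hx
  have h2 := fun j => integrable_exp_norm_inner_sq
    ((EuclideanSpace.basisFun (Fin n) ℂ).norm_eq_one j)
  have hj : ∀ j, Integrable (fun b => Real.exp (‖inner ℂ b x‖ ^ 2 / 4) +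
        Real.exp (‖inner ℂ b (EuclideanSpace.basisFun (Fin n) ℂ j)‖ ^ 2 / 4))
        (complexGaussian n) := fun j => h1.1.add (h2 j).1
  have hs : Integrable (fun b => ∑ j, (Real.exp (‖inner ℂ b x‖ ^ 2 / 4) +
        Real.exp (‖inner ℂ b (EuclideanSpace.basisFun (Fin n) ℂ j)‖ ^ 2 / 4)))
        (complexGaussian n) :=
    integrable_finsetSum _ fun j _ => hj j
  have hi := hs.const_mul (64 * Real.exp (-(T / 16)))
  have hi2 : Integrable (fun b => if T < ‖inner ℂ b x‖ ^ 2 then ‖inner ℂ b x‖ ^ 2 * ‖b‖ ^ 2 else 0)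
      (complexGaussian n) := by
    refine hi.mono (measurable_largeSample x T).aestronglyMeasurable (ae_of_all _ fun b => ?_)
    rw [Real.norm_of_nonneg (by split_ifs <;> positivity)]
    exact (hle b).trans (le_abs_self _)
  refine ⟨hi2, (integral_mono hi2 hi hle).trans ?_⟩
  rw [integral_const_mul, integral_finsetSum _ fun j _ => hj j]
  have : ∑ j, ∫ b, (Real.exp (‖inner ℂ b x‖ ^ 2 / 4) +
        Real.exp (‖inner ℂ b (EuclideanSpace.basisFun (Fin n) ℂ j)‖ ^ 2 / 4))
        ∂(complexGaussian n) ≤ ∑ _j : Fin n, (4 : ℝ) := by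
    refine Finset.sum_le_sum fun j _ => ?_
    rw [integral_add h1.1 (h2 j).1]
    linarith [h1.2, (h2 j).2]
  simp only [Finset.sum_const, Finset.card_univ, Fintype.card_fin, nsmul_eq_mul] at this
  calc _ ≤ 64 * Real.exp (-(T / 16)) * (n * 4) := by gcongr
    _ = _ := by ring

/-- Exponential second moment of the truncated weighted energy. -/
lemma integral_truncated_sq_mul_exp_le {x w : EuclideanSpace ℂ (Fin n)} (hx : ‖x‖ = 1)
    (hw : ‖w‖ = 1) {g : EuclideanSpace ℂ (Fin n) → ℝ} (hg : Measurable g) (h0 : ∀ b, 0 ≤ g b)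
    (hgx : ∀ b, g b ≤ ‖inner ℂ b x‖ ^ 2) {θ : ℝ} (hgθ : ∀ b, θ * g b ≤ 1 / 16) :
    Integrable (fun b => (g b * ‖inner ℂ b w‖ ^ 2) ^ 2 *
      Real.exp (θ * (g b * ‖inner ℂ b w‖ ^ 2))) (complexGaussian n) ∧
    ∫ b, (g b * ‖inner ℂ b w‖ ^ 2) ^ 2 * Real.exp (θ * (g b * ‖inner ℂ b w‖ ^ 2))
      ∂(complexGaussian n) ≤ 131072 := by
  have hle : ∀ b : EuclideanSpace ℂ (Fin n), (g b * ‖inner ℂ b w‖ ^ 2) ^ 2 *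
      Real.exp (θ * (g b * ‖inner ℂ b w‖ ^ 2)) ≤
      32768 * (Real.exp (‖inner ℂ b x‖ ^ 2 / 4) + Real.exp (‖inner ℂ b w‖ ^ 2 / 4)) := fun b => by
    have hgx := hgx b
    have hgθ := hgθ b
    have h0 := h0 b
    set p := ‖inner ℂ b x‖ ^ 2
    set q := ‖inner ℂ b w‖ ^ 2
    have hp : 0 ≤ p := by positivity
    have hq : 0 ≤ q := by positivity
    have e1 : Real.exp (p / 4) = Real.exp (p / 8) ^ 2 := by
      rw [← Real.exp_nat_mul]; congr 1; push_cast; ring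
    have e2 : Real.exp (q / 4) = Real.exp (q / 8) ^ 2 := by
      rw [← Real.exp_nat_mul]; congr 1; push_cast; ring
    have h1 : p ^ 2 ≤ 128 * Real.exp (p / 8) := by
      have := Real.quadratic_le_exp_of_nonneg (show 0 ≤ p / 8 by positivity)
      nlinarith
    have h2 : q ^ 2 ≤ 512 * Real.exp (q / 16) := by
      have := Real.quadratic_le_exp_of_nonneg (show 0 ≤ q / 16 by positivity)
      nlinarith
    -- The only use of the truncation: with θg ≤ 1/16 the exponent is quadratic, not quartic, in the
    -- Gaussians.
    have h3 : Real.exp (θ * (g b * q)) ≤ Real.exp (q / 16) := by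
      apply Real.exp_le_exp.2
      nlinarith
    have h4 : 2 * (Real.exp (p / 8) * Real.exp (q / 8)) ≤
        Real.exp (p / 8) ^ 2 + Real.exp (q / 8) ^ 2 := by
      nlinarith [sq_nonneg (Real.exp (p / 8) - Real.exp (q / 8))]
    have h5 : Real.exp (q / 16) * Real.exp (q / 16) = Real.exp (q / 8) := by
      rw [← Real.exp_add]; congr 1; ring
    rw [e1, e2]
    calc (g b * q) ^ 2 * Real.exp (θ * (g b * q)) ≤ (p * q) ^ 2 * Real.exp (q / 16) := by gcongr
      _ = p ^ 2 * q ^ 2 * Real.exp (q / 16) := by ring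
      _ ≤ (128 * Real.exp (p / 8)) * (512 * Real.exp (q / 16)) * Real.exp (q / 16) := by gcongr
      _ = 32768 * (2 * (Real.exp (p / 8) * (Real.exp (q / 16) * Real.exp (q / 16)))) := by ring
      _ ≤ _ := by rw [h5]; gcongr
  have h1 := integrable_exp_norm_inner_sq hx
  have h2 := integrable_exp_norm_inner_sq hw
  have hs : Integrable (fun b => 32768 * (Real.exp (‖inner ℂ b x‖ ^ 2 / 4) +
      Real.exp (‖inner ℂ b w‖ ^ 2 / 4))) (complexGaussian n) := (h1.1.add h2.1).const_mul _
  have hi : Integrable (fun b => (g b * ‖inner ℂ b w‖ ^ 2) ^ 2 *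
      Real.exp (θ * (g b * ‖inner ℂ b w‖ ^ 2))) (complexGaussian n) := by
    refine hs.mono (by fun_prop) (ae_of_all _ fun b => ?_)
    rw [Real.norm_of_nonneg (by positivity)]
    exact (hle b).trans (le_abs_self _)
  refine ⟨hi, (integral_mono hi hs hle).trans ?_⟩
  rw [integral_const_mul, integral_add h1.1 h2.1]
  linarith [h1.2, h2.2]

end GoodEvent

/-! ### The conditions hold with high probability -/

section GoodEventProbability

variable {n m : ℕ} {Ω : Type*} [MeasurableSpace Ω] {P : Measure Ω}
  {a : Fin m → Ω → EuclideanSpace ℂ (Fin n)}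

/-- The union bound over a `10⁻⁷`-net of the unit sphere. -/
lemma measureReal_biUnion_net_le {N : Finset (EuclideanSpace ℂ (Fin n))}
    (hN : (N.card : ℝ) ≤ ((1 + 2 / (1 / 10 ^ 7 : ℝ)) ^ 2) ^ n)
    {B : EuclideanSpace ℂ (Fin n) → Set Ω} (hB : ∀ c ∈ N, P.real (B c) ≤ Real.exp (-(41 * n))) :
    P.real (⋃ c ∈ N, B c) ≤ Real.exp (-n) := by
  -- The net has at most e^{40n} points, so failure probability e^{-41n} at each point suffices.
  have h40 : (1 + 2 / (1 / 10 ^ 7 : ℝ)) ^ 2 ≤ Real.exp 40 := by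
    have h1 : Real.exp 40 = Real.exp 1 ^ 40 := by rw [← Real.exp_nat_mul]; norm_num
    have h2 : (2.7 : ℝ) ≤ Real.exp 1 := by linarith [Real.exp_one_gt_d9]
    calc (1 + 2 / (1 / 10 ^ 7 : ℝ)) ^ 2 ≤ (2.7 : ℝ) ^ 40 := by norm_num
      _ ≤ Real.exp 1 ^ 40 := by gcongr
      _ = _ := h1.symm
  calc P.real (⋃ c ∈ N, B c) ≤ ∑ c ∈ N, P.real (B c) := measureReal_biUnion_finset_le _ _
    _ ≤ ∑ _c ∈ N, Real.exp (-(41 * n)) := Finset.sum_le_sum hB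
    _ = N.card * Real.exp (-(41 * n)) := by simp
    _ ≤ Real.exp 40 ^ n * Real.exp (-(41 * n)) := by
        gcongr
        exact hN.trans (by gcongr)
    _ = Real.exp (-n) := by
        rw [← Real.exp_nat_mul, ← Real.exp_add]; congr 1; ring

lemma integral_norm_inner_sq_sq_mul_exp_le {w : EuclideanSpace ℂ (Fin n)} (hw : ‖w‖ = 1) {θ : ℝ}
    (hθ : θ ≤ 1 / 8) :
    Integrable (fun b => (‖inner ℂ b w‖ ^ 2) ^ 2 * Real.exp (θ * ‖inner ℂ b w‖ ^ 2))
      (complexGaussian n) ∧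
    ∫ b, (‖inner ℂ b w‖ ^ 2) ^ 2 * Real.exp (θ * ‖inner ℂ b w‖ ^ 2) ∂(complexGaussian n) ≤ 256 := by
  have hle : ∀ b : EuclideanSpace ℂ (Fin n), (‖inner ℂ b w‖ ^ 2) ^ 2 *
      Real.exp (θ * ‖inner ℂ b w‖ ^ 2) ≤ 128 * Real.exp (‖inner ℂ b w‖ ^ 2 / 4) := fun b => by
    set q := ‖inner ℂ b w‖ ^ 2
    have hq : 0 ≤ q := by positivity
    have h1 : q ^ 2 ≤ 128 * Real.exp (q / 8) := by
      have := Real.quadratic_le_exp_of_nonneg (show 0 ≤ q / 8 by positivity)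
      nlinarith
    have h3 : Real.exp (θ * q) ≤ Real.exp (q / 8) := by
      apply Real.exp_le_exp.2
      nlinarith
    calc _ ≤ (128 * Real.exp (q / 8)) * Real.exp (q / 8) := by gcongr
      _ = _ := by rw [mul_assoc, ← Real.exp_add]; ring_nf
  have h1 := integrable_exp_norm_inner_sq hw
  have hi : Integrable (fun b => (‖inner ℂ b w‖ ^ 2) ^ 2 * Real.exp (θ * ‖inner ℂ b w‖ ^ 2))
      (complexGaussian n) := by
    refine (h1.1.const_mul 128).mono (by fun_prop) (ae_of_all _ fun b => ?_)
    rw [Real.norm_of_nonneg (by positivity)]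
    exact (hle b).trans (le_abs_self _)
  refine ⟨hi, (integral_mono hi (h1.1.const_mul 128) hle).trans ?_⟩
  rw [integral_const_mul]
  linarith [h1.2]

variable [IsProbabilityMeasure P]

/-- The sampling operator is bounded with high probability. -/
lemma IsGaussianModel.exists_upper (ha : IsGaussianModel P a) (hm : 10 ^ 15 * (n : ℝ) ≤ m) :
    ∃ E : Set Ω, MeasurableSet E ∧ P.real Eᶜ ≤ Real.exp (-n) ∧ ∀ ω ∈ E, ∀ w,
      ∑ r, ‖inner ℂ (a r ω) w‖ ^ 2 ≤ 1001 / 1000 * m * ‖w‖ ^ 2 := by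
  obtain ⟨N, hN1, hNc, hN⟩ := exists_net_unit_sphere n (ε := 1 / 10 ^ 7) (by norm_num)
  let B : EuclideanSpace ℂ (Fin n) → Set Ω := fun c =>
    {ω | m * (1 + 1 / 2000) ≤ ∑ r, ‖inner ℂ (a r ω) c‖ ^ 2}
  have hBm : ∀ c, MeasurableSet (B c) := fun c =>
    ha.measurableSet_le_sum (f := fun b => ‖inner ℂ b c‖ ^ 2) (by fun_prop) _
  refine ⟨(⋃ c ∈ N, B c)ᶜ, (N.measurableSet_biUnion fun c _ => hBm c).compl, ?_, ?_⟩
  · rw [compl_compl]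
    refine measureReal_biUnion_net_le hNc fun c hc => ?_
    -- With δ = 1/2000 and V = 256, the exponent θδ − θ²V is about 2.4·10⁻¹⁰, ample against m ≥
    -- 10¹⁵n.
    have hV := integral_norm_inner_sq_sq_mul_exp_le (hN1 c hc) (θ := 1 / 10 ^ 6) (by norm_num)
    refine (ha.measure_upper_tail_le (X := fun b => ‖inner ℂ b c‖ ^ 2) (by fun_prop)
      (fun b => by positivity) (integrable_norm_inner_pow c 2) (κ := 1)
      (by rw [integral_norm_inner_sq, hN1 c hc]; norm_num) (by norm_num) hV.1 hV.2 _).trans ?_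
    apply Real.exp_le_exp.2
    norm_num
    have : (0 : ℝ) ≤ n := by positivity
    linarith
  · intro ω hω w
    have hω' : ∀ c ∈ N, ∑ r, (1 : ℝ) * ‖inner ℂ (a r ω) c‖ ^ 2 ≤ m * (1 + 1 / 2000) := by
      intro c hc
      simp only [Set.compl_iUnion, Set.mem_iInter] at hω
      simp only [one_mul]
      exact (not_le.1 fun h => hω c hc h).le
    have := sum_weighted_norm_inner_sq_le_of_net (fun r => a r ω) (γ := fun _ => (1 : ℝ))
      (fun _ => zero_le_one) (ε := 1 / 10 ^ 7) (by norm_num) (by norm_num) hN hω' w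
    simp only [one_mul] at this
    refine this.trans ?_
    have hm0 : (0 : ℝ) ≤ m := by positivity
    have : (1 + 4 * (1 / 10 ^ 7)) * (m * (1 + 1 / 2000)) ≤ 1001 / 1000 * (m : ℝ) := by linarith
    gcongr

lemma abs_sub_norm_inner_le (x : EuclideanSpace ℂ (Fin n)) (hx : ‖x‖ = 1)
    (w c : EuclideanSpace ℂ (Fin n)) : ‖inner ℂ x w - inner ℂ x c‖ ≤ ‖w - c‖ := by
  rw [← inner_sub_right]
  simpa [hx] using norm_inner_le_norm (𝕜 := ℂ) x (w - c)

/-- The weighted sampling operator is sharply bounded with high probability. -/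
lemma IsGaussianModel.exists_weighted (ha : IsGaussianModel P a) (hn : 10 ^ 6 ≤ n)
    (hm : 10 ^ 15 * (n : ℝ) * Real.log n ≤ m) {x : EuclideanSpace ℂ (Fin n)} (hx : ‖x‖ = 1) :
    ∃ E : Set Ω, MeasurableSet E ∧ P.real Eᶜ ≤ Real.exp (-n) + 1 / (n : ℝ) ^ 2 ∧ ∀ ω ∈ E, ∀ w,
      ‖w‖ = 1 → ∑ r, ‖inner ℂ (a r ω) x‖ ^ 2 * ‖inner ℂ (a r ω) w‖ ^ 2 ≤
        m * (1001 / 1000 + ‖inner ℂ x w‖ ^ 2) := by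
  have hn' : (10 : ℝ) ^ 6 ≤ n := by exact_mod_cast hn
  have hlog : 1 ≤ Real.log n := by
    rw [Real.le_log_iff_exp_le (by linarith)]
    linarith [Real.exp_one_lt_d9]
  set L := Real.log n with hL
  have hm1 : 10 ^ 15 * (n : ℝ) ≤ m := by nlinarith
  have hm0 : (0 : ℝ) < m := by linarith
  obtain ⟨N, hN1, hNc, hN⟩ := exists_net_unit_sphere n (ε := 1 / 10 ^ 7) (by norm_num)
  -- The weight |b^*x|² is split at 64 log n: the bounded part g admits a Chernoff bound on the net,
  -- and the rest l is handled by Markov's inequality uniformly in w through |b^*w| ≤ ‖b‖.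
  let g : EuclideanSpace ℂ (Fin n) → ℝ := fun b =>
    if 64 * L < ‖inner ℂ b x‖ ^ 2 then 0 else ‖inner ℂ b x‖ ^ 2
  have hg : Measurable g :=
    Measurable.ite (measurableSet_lt measurable_const (by fun_prop)) measurable_const (by fun_prop)
  have hg0 : ∀ b, 0 ≤ g b := fun b => by simp only [g]; split_ifs <;> positivity
  have hgx : ∀ b, g b ≤ ‖inner ℂ b x‖ ^ 2 := fun b => by
    simp only [g]; split_ifs
    · positivity
    · exact le_rfl
  have hgL : ∀ b, g b ≤ 64 * L := fun b => by
    simp only [g]; split_ifs with h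
    · positivity
    · exact not_lt.1 h
  let l : EuclideanSpace ℂ (Fin n) → ℝ := fun b =>
    if 64 * L < ‖inner ℂ b x‖ ^ 2 then ‖inner ℂ b x‖ ^ 2 * ‖b‖ ^ 2 else 0
  have hl : Measurable l := measurable_largeSample x _
  have hl0 : ∀ b, 0 ≤ l b := fun b => by simp only [l]; split_ifs <;> positivity
  have hgl : ∀ b w, ‖w‖ = 1 → ‖inner ℂ b x‖ ^ 2 * ‖inner ℂ b w‖ ^ 2 ≤
      g b * ‖inner ℂ b w‖ ^ 2 + l b := fun b w hw => by
    simp only [g, l]; split_ifs with h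
    · have : ‖inner ℂ b w‖ ≤ ‖b‖ := by simpa [hw] using norm_inner_le_norm (𝕜 := ℂ) b w
      rw [zero_mul, zero_add]
      gcongr
    · simp
  let B : EuclideanSpace ℂ (Fin n) → Set Ω := fun c =>
    {ω | m * ((1 + ‖inner ℂ x c‖ ^ 2) + 4 / 10000) ≤ ∑ r, g (a r ω) * ‖inner ℂ (a r ω) c‖ ^ 2}
  have hBm : ∀ c, MeasurableSet (B c) := fun c =>
    ha.measurableSet_le_sum (f := fun b => g b * ‖inner ℂ b c‖ ^ 2) (by fun_prop) _
  let B' : Set Ω := {ω | m * (4 / 10000 : ℝ) ≤ ∑ r, l (a r ω)}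
  have hBm' : MeasurableSet B' := ha.measurableSet_le_sum hl _
  have hP : P.real (⋃ c ∈ N, B c) ≤ Real.exp (-n) := by
    refine measureReal_biUnion_net_le hNc fun c hc => ?_
    have hθ0 : 0 ≤ 1 / (10 ^ 9 * L) := by positivity
    have hV := integral_truncated_sq_mul_exp_le hx (hN1 c hc) hg hg0 hgx
      (θ := 1 / (10 ^ 9 * L)) fun b => by
        calc 1 / (10 ^ 9 * L) * g b ≤ 1 / (10 ^ 9 * L) * (64 * L) := by gcongr; exact hgL b
          _ = 64 / 10 ^ 9 := by field_simp
          _ ≤ _ := by norm_num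
    have hj := integrable_norm_sq_mul_norm_sq x c
    have hX : ∀ b, g b * ‖inner ℂ b c‖ ^ 2 ≤ ‖inner ℂ b x‖ ^ 2 * ‖inner ℂ b c‖ ^ 2 := fun b => by
      gcongr; exact hgx b
    have hi : Integrable (fun b => g b * ‖inner ℂ b c‖ ^ 2) (complexGaussian n) := by
      refine hj.mono (by fun_prop) (ae_of_all _ fun b => ?_)
      rw [Real.norm_of_nonneg (mul_nonneg (hg0 b) (by positivity))]
      exact (hX b).trans (le_abs_self _)
    refine (ha.measure_upper_tail_le (X := fun b => g b * ‖inner ℂ b c‖ ^ 2) (by fun_prop)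
      (fun b => mul_nonneg (hg0 b) (by positivity)) hi (κ := 1 + ‖inner ℂ x c‖ ^ 2)
      ((integral_mono hi hj hX).trans_eq (integral_norm_sq_mul_norm_sq hx (hN1 c hc)))
      hθ0 hV.1 hV.2 _).trans ?_
    apply Real.exp_le_exp.2
    -- The exponent per sample is only of order 1/log n because θ must shrink with the truncation
    -- level; this is where m ≥ c₀ n log n is used.
    have h1 : 1 / (10 ^ 9 * L) * (4 / 10000) - (1 / (10 ^ 9 * L)) ^ 2 * 131072 ≥
        2 / 10 ^ 13 / L := by
      have e : 1 / (10 ^ 9 * L) * (4 / 10000) - (1 / (10 ^ 9 * L)) ^ 2 * 131072 - 2 / 10 ^ 13 / L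
        = (2 / 10 ^ 13 - 131072 / 10 ^ 18 / L) / L := by field_simp; ring
      have h2 : 131072 / 10 ^ 18 / L ≤ 131072 / 10 ^ 18 := div_le_self (by norm_num) hlog
      have : 0 ≤ (2 / 10 ^ 13 - 131072 / 10 ^ 18 / L) / L :=
        div_nonneg (by linarith) (by linarith)
      linarith
    have h3 : (41 : ℝ) * n ≤ m * (2 / 10 ^ 13 / L) := by
      have : m * (2 / 10 ^ 13 / L) = m * (2 / 10 ^ 13) / L := by ring
      rw [this, le_div_iff₀ (by linarith)]
      nlinarith
    have h4 := mul_le_mul_of_nonneg_left h1 hm0.le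
    linarith
  have hP' : P.real B' ≤ 1 / (n : ℝ) ^ 2 := by
    have hint := integral_largeSample_le hx (64 * L)
    refine (ha.measure_le_sum_le hl hl0 hint.1 (by positivity)).trans ?_
    -- The mean of l is then at most 256 n⁻³. One factor 1/n absorbs the constant 640000, as n ≥
    -- 10⁶, and n⁻² remains.
    have e : Real.exp (-(64 * L / 16)) = ((n : ℝ) ^ 4)⁻¹ := by
      rw [Real.exp_neg, show 64 * L / 16 = (4 : ℕ) * L by push_cast; ring, Real.exp_nat_mul, hL,
        Real.exp_log (by linarith)]
    rw [e] at hint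
    have hn0 : (0 : ℝ) < n := by linarith
    calc m * (∫ b, l b ∂(complexGaussian n)) / (m * (4 / 10000 : ℝ))
        ≤ m * (256 * n * ((n : ℝ) ^ 4)⁻¹) / (m * (4 / 10000 : ℝ)) := by
          gcongr
          exact hint.2
      _ = 640000 / n / (n : ℝ) ^ 2 := by field_simp; norm_num
      _ ≤ 1 / (n : ℝ) ^ 2 := by
          gcongr
          rw [div_le_one hn0]
          linarith
  refine ⟨((⋃ c ∈ N, B c) ∪ B')ᶜ,
    ((N.measurableSet_biUnion fun c _ => hBm c).union hBm').compl, ?_, ?_⟩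
  · rw [compl_compl]
    exact (measureReal_union_le _ _).trans (add_le_add hP hP')
  · intro ω hω w hw
    simp only [Set.compl_union, Set.compl_iUnion, Set.mem_inter_iff, Set.mem_iInter] at hω
    obtain ⟨hω1, hω2⟩ := hω
    have hc1 : ∀ c ∈ N, ∑ r, g (a r ω) * ‖inner ℂ (a r ω) c‖ ^ 2 ≤
        m * ((1 + ‖inner ℂ x c‖ ^ 2) + 4 / 10000) := fun c hc => (not_le.1 fun h => hω1 c hc h).le
    have hl1 : ∑ r, l (a r ω) ≤ m * (4 / 10000 : ℝ) := (not_le.1 fun h => hω2 h).le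
    have hle1 : ∀ v : EuclideanSpace ℂ (Fin n), ‖v‖ = 1 → ‖inner ℂ x v‖ ≤ 1 := fun v hv => by
      simpa [hx, hv] using norm_inner_le_norm (𝕜 := ℂ) x v
    -- A crude uniform bound suffices for the small vector w − c. The sharp bound is used only at
    -- the net point c, because it varies with |x^*c|².
    have hc2 : ∀ c ∈ N, ∑ r, g (a r ω) * ‖inner ℂ (a r ω) c‖ ^ 2 ≤ m * (5 / 2) := fun c hc => by
      refine (hc1 c hc).trans ?_
      have : ‖inner ℂ x c‖ ^ 2 ≤ 1 := pow_le_one₀ (norm_nonneg _) (hle1 c (hN1 c hc))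
      gcongr
      linarith
    have hcr := sum_weighted_norm_inner_sq_le_of_net (fun r => a r ω) (γ := fun r => g (a r ω))
      (fun r => hg0 _) (ε := 1 / 10 ^ 7) (by norm_num) (by norm_num) hN hc2
    obtain ⟨c, hc, hcw⟩ := hN w hw
    have hd := hcr (w - c)
    have hQ := sum_weighted_norm_inner_sq_le_add (fun r => a r ω) (γ := fun r => g (a r ω))
      (fun r => hg0 _) (ε := 1 / 10 ^ 7) (by norm_num) w c
    have hd2 : ∑ r, g (a r ω) * ‖inner ℂ (a r ω) (w - c)‖ ^ 2 ≤ m * 3 * (1 / 10 ^ 7) ^ 2 := by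
      refine hd.trans ?_
      have : (1 + 4 * (1 / 10 ^ 7)) * (m * (5 / 2 : ℝ)) ≤ m * 3 := by linarith
      gcongr
    have hs : ‖inner ℂ x c‖ ^ 2 ≤ ‖inner ℂ x w‖ ^ 2 + 2 * (1 / 10 ^ 7) := by
      have h1 := norm_le_norm_add_norm_sub (inner ℂ x w) (inner ℂ x c)
      have h2 := (abs_sub_norm_inner_le x hx w c).trans hcw
      have h3 := hle1 w hw
      have h4 := hle1 c (hN1 c hc)
      nlinarith [norm_nonneg (inner ℂ x c), norm_nonneg (inner ℂ x w)]
    have hfin : ∑ r, ‖inner ℂ (a r ω) x‖ ^ 2 * ‖inner ℂ (a r ω) w‖ ^ 2 ≤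
        ∑ r, g (a r ω) * ‖inner ℂ (a r ω) w‖ ^ 2 + ∑ r, l (a r ω) := by
      rw [← Finset.sum_add_distrib]
      exact Finset.sum_le_sum fun r _ => hgl _ w hw
    have hQc := hc1 c hc
    have hw1 : ‖inner ℂ x w‖ ^ 2 ≤ 1 := pow_le_one₀ (norm_nonneg _) (hle1 w hw)
    have hms := mul_le_mul_of_nonneg_left hs hm0.le
    have hmw := mul_le_mul_of_nonneg_left hw1 hm0.le
    norm_num at hQ hd2 hms hmw ⊢
    nlinarith

/-- The cut-off bounds the sum of the two values by 20000 in the factored difference of squares, so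
the squares differ linearly in D. -/
lemma min_sq_le_sq_add {p p' D : ℝ} (hp' : 0 ≤ p') (hp : 0 ≤ p) (hD : 0 ≤ D) (h : p' ≤ p + D) :
    min p' 10000 ^ 2 ≤ p ^ 2 + 20000 * D := by
  have h0 : 0 ≤ min p' 10000 := le_min hp' (by norm_num)
  rcases le_total (min p' 10000) p with h1 | h1
  · have : min p' 10000 ^ 2 ≤ p ^ 2 := by gcongr
    linarith
  · have h2 : min p' 10000 - p ≤ D := by linarith [min_le_left p' 10000]
    have h3 : min p' 10000 + p ≤ 20000 := by linarith [min_le_right p' 10000]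
    have h4 : (min p' 10000 - p) * (min p' 10000 + p) ≤ D * 20000 :=
      mul_le_mul h2 h3 (by linarith) hD
    linarith

/-- The squared curvature gap is bounded below with high probability. -/
lemma IsGaussianModel.exists_curvature (ha : IsGaussianModel P a) (hm : 10 ^ 15 * (n : ℝ) ≤ m)
    {x : EuclideanSpace ℂ (Fin n)} (hx : ‖x‖ = 1) :
    ∃ E : Set Ω, MeasurableSet E ∧ P.real Eᶜ ≤ Real.exp (-n) ∧ ∀ ω ∈ E,
      (∀ w, ∑ r, ‖inner ℂ (a r ω) w‖ ^ 2 ≤ 1001 / 1000 * m * ‖w‖ ^ 2) →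
      ∀ w, ‖w‖ = 1 → (inner ℂ x w).im = 0 →
        m * (4 / 5 + 3 / 5 * (inner ℂ x w).re ^ 2) ≤ ∑ r, curvGap (a r ω) x w ^ 2 := by
  have hm0 : (0 : ℝ) ≤ m := by positivity
  obtain ⟨N, hN1, hNc, hN⟩ := exists_net_unit_sphere n (ε := 1 / 10 ^ 7) (by norm_num)
  let B : EuclideanSpace ℂ (Fin n) → Set Ω := fun c =>
    {ω | ∑ r, min (curvGap (a r ω) x c) 10000 ^ 2 ≤
      m * ((9 / 10 + 3 * (inner ℂ x c).re ^ 2 - 2 * (inner ℂ x c).im ^ 2) - 1 / 50)}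
  have hBm : ∀ c, MeasurableSet (B c) := fun c =>
    measurableSet_le (Finset.measurable_fun_sum _ fun r _ => by
      have := (measurable_curvGap x c).comp (ha.measurable r)
      simp only [Function.comp_def] at this
      fun_prop) measurable_const
  refine ⟨(⋃ c ∈ N, B c)ᶜ, (N.measurableSet_biUnion fun c _ => hBm c).compl, ?_, ?_⟩
  · rw [compl_compl]
    refine measureReal_biUnion_net_le hNc fun c hc => ?_
    obtain ⟨hi, hk⟩ := le_integral_min_curvGap_sq hx (hN1 c hc)
    have h4 := integrable_curvGap_pow_four x c
    have hle : ∀ b, (min (curvGap b x c) 10000 ^ 2) ^ 2 ≤ curvGap b x c ^ 4 := fun b => by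
      rw [← pow_mul]
      have : 0 ≤ min (curvGap b x c) 10000 := le_min (curvGap_nonneg b x c) (by norm_num)
      gcongr
      exact min_le_left _ _
    have hi2 : Integrable (fun b => (min (curvGap b x c) 10000 ^ 2) ^ 2) (complexGaussian n) := by
      refine h4.mono (by fun_prop) (ae_of_all _ fun b => ?_)
      rw [Real.norm_of_nonneg (by positivity)]
      exact (hle b).trans (le_abs_self _)
    refine (ha.measure_lower_tail_le (X := fun b => min (curvGap b x c) 10000 ^ 2) (by fun_prop)
      (fun b => by positivity) hi hk hi2 (V := 82000) (by norm_num)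
      ((integral_mono hi2 h4 hle).trans (integral_curvGap_pow_four_le hx (hN1 c hc)))
      (by norm_num)).trans ?_
    apply Real.exp_le_exp.2
    norm_num
    have : (0 : ℝ) ≤ n := by positivity
    linarith
  · intro ω hω hup w hw him
    obtain ⟨c, hc, hcw⟩ := hN w hw
    simp only [Set.compl_iUnion, Set.mem_iInter] at hω
    have hωc : m * ((9 / 10 + 3 * (inner ℂ x c).re ^ 2 - 2 * (inner ℂ x c).im ^ 2) - 1 / 50) ≤
      ∑ r, min (curvGap (a r ω) x c) 10000 ^ 2 := (not_le.1 fun h => hω c hc h).le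
    have hc1 := hN1 c hc
    -- Young's inequality with weights 10⁻⁷ and 10⁷, matched to the net: the displacement terms sum
    -- to order 10⁻¹⁴ m, so every error is of order 20000·10⁻⁷ m, within the slack m/50.
    have hlip : ∀ r, min (curvGap (a r ω) x c) 10000 ^ 2 ≤ curvGap (a r ω) x w ^ 2 +
        20000 * (8 / 5 * (1 / 2 * (1 / 10 ^ 7 * ‖inner ℂ (a r ω) x‖ ^ 2 +
            10 ^ 7 * ‖inner ℂ (a r ω) (w - c)‖ ^ 2)) +
          15 / 128 * (1 / 10 ^ 7 * (‖inner ℂ (a r ω) w‖ ^ 2 + ‖inner ℂ (a r ω) c‖ ^ 2) +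
            1 / 2 * (10 ^ 7 * ‖inner ℂ (a r ω) (w - c)‖ ^ 2))) := by
      intro r
      have hR : |correl (a r ω) x c| ≤ |correl (a r ω) x w| +
          ‖inner ℂ (a r ω) x‖ * ‖inner ℂ (a r ω) (w - c)‖ := by
        have h1 := abs_correl_le (a r ω) x (w - c)
        have h2 : correl (a r ω) x (w - c) = correl (a r ω) x w - correl (a r ω) x c := by
          simp only [correl, inner_sub_right, mul_sub, Complex.sub_re]
        rw [h2] at h1
        have h3 := abs_sub_abs_le_abs_sub (correl (a r ω) x c) (correl (a r ω) x w)
        rw [abs_sub_comm] at h3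
        linarith
      have hv : ‖inner ℂ (a r ω) w‖ ≤ ‖inner ℂ (a r ω) c‖ + ‖inner ℂ (a r ω) (w - c)‖ := by
        have := norm_add_le (inner ℂ (a r ω) c) (inner ℂ (a r ω) (w - c))
        rwa [← inner_add_right, add_sub_cancel] at this
      have hp0 := curvGap_nonneg (a r ω) x w
      have hp1 : 8 / 5 * |correl (a r ω) x w| - 15 / 128 * ‖inner ℂ (a r ω) w‖ ^ 2 ≤
        curvGap (a r ω) x w := le_max_right _ _
      have hpc : curvGap (a r ω) x c =
        max 0 (8 / 5 * |correl (a r ω) x c| - 15 / 128 * ‖inner ℂ (a r ω) c‖ ^ 2) := rfl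
      have hp0' := curvGap_nonneg (a r ω) x c
      generalize curvGap (a r ω) x w = p at *
      generalize curvGap (a r ω) x c = p' at *
      set u := ‖inner ℂ (a r ω) x‖
      set v := ‖inner ℂ (a r ω) w‖
      set v' := ‖inner ℂ (a r ω) c‖
      set d := ‖inner ℂ (a r ω) (w - c)‖
      have hu0 : 0 ≤ u := norm_nonneg _
      have hv0 : 0 ≤ v := norm_nonneg _
      have hv0' : 0 ≤ v' := norm_nonneg _
      have hd0 : 0 ≤ d := norm_nonneg _
      have hud : u * d ≤ 1 / 2 * (1 / 10 ^ 7 * u ^ 2 + 10 ^ 7 * d ^ 2) := by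
        nlinarith [sq_nonneg (u - 10 ^ 7 * d)]
      have hvd : (v + v') * d ≤ 1 / 10 ^ 7 * (v ^ 2 + v' ^ 2) + 1 / 2 * (10 ^ 7 * d ^ 2) := by
        nlinarith [sq_nonneg (v + v' - 10 ^ 7 * d), sq_nonneg (v - v')]
      have hvv : v ^ 2 - v' ^ 2 ≤ (v + v') * d := by nlinarith
      have hpp : p' ≤ p + (8 / 5 * (1 / 2 * (1 / 10 ^ 7 * u ^ 2 + 10 ^ 7 * d ^ 2)) +
          15 / 128 * (1 / 10 ^ 7 * (v ^ 2 + v' ^ 2) + 1 / 2 * (10 ^ 7 * d ^ 2))) := by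
        rw [hpc]
        refine max_le (by positivity) ?_
        linarith
      have hD : 0 ≤ 8 / 5 * (1 / 2 * (1 / 10 ^ 7 * u ^ 2 + 10 ^ 7 * d ^ 2)) +
          15 / 128 * (1 / 10 ^ 7 * (v ^ 2 + v' ^ 2) + 1 / 2 * (10 ^ 7 * d ^ 2)) := by positivity
      exact min_sq_le_sq_add hp0' hp0 hD hpp
    have hsum := Finset.sum_le_sum fun r (_ : r ∈ Finset.univ) => hlip r
    simp only [Finset.sum_add_distrib, ← Finset.mul_sum] at hsum
    have hux := hup x
    have huw := hup w
    have huc := hup c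
    have hud : ∑ r, ‖inner ℂ (a r ω) (w - c)‖ ^ 2 ≤ 1001 / 1000 * m * (1 / 10 ^ 7) ^ 2 := by
      refine (hup (w - c)).trans ?_
      gcongr
    rw [hx] at hux
    rw [hw] at huw
    rw [hc1] at huc
    have hre : |(inner ℂ x w).re - (inner ℂ x c).re| ≤ 1 / 10 ^ 7 := by
      rw [← Complex.sub_re]
      exact (Complex.abs_re_le_norm _).trans ((abs_sub_norm_inner_le x hx w c).trans hcw)
    have him' : |(inner ℂ x c).im| ≤ 1 / 10 ^ 7 := by
      have h := (Complex.abs_im_le_norm _).trans ((abs_sub_norm_inner_le x hx w c).trans hcw)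
      rwa [Complex.sub_im, him, zero_sub, abs_neg] at h
    have hrw : |(inner ℂ x w).re| ≤ 1 := by
      refine (Complex.abs_re_le_norm _).trans ?_
      simpa [hx, hw] using norm_inner_le_norm (𝕜 := ℂ) x w
    -- Since x^*w is real, the negative Im² term at c is negligible; the extra 1/50 pays for the
    -- passage from c to w.
    have h1 : 4 / 5 + 3 / 5 * (inner ℂ x w).re ^ 2 + 1 / 50 ≤
        (9 / 10 + 3 * (inner ℂ x c).re ^ 2 - 2 * (inner ℂ x c).im ^ 2) - 1 / 50 := by
      rw [abs_le] at hre him' hrw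
      have h2 : (inner ℂ x c).im ^ 2 ≤ (1 / 10 ^ 7) ^ 2 := sq_le_sq' him'.1 him'.2
      have h3 : (inner ℂ x w).re ^ 2 ≤ (inner ℂ x c).re ^ 2 + 4 * (1 / 10 ^ 7) := by
        norm_num at hre ⊢
        nlinarith
      norm_num at h2 h3
      nlinarith [sq_nonneg (inner ℂ x c).re]
    have h2 := mul_le_mul_of_nonneg_left h1 hm0
    norm_num at hud hux huw huc hsum ⊢
    linarith

/-- With high probability all the conditions needed for Wirtinger flow hold. -/
lemma IsGaussianModel.exists_wellConditioned (ha : IsGaussianModel P a) (hn : 10 ^ 6 ≤ n)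
    (hm : 10 ^ 15 * (n : ℝ) * Real.log n ≤ m) {x : EuclideanSpace ℂ (Fin n)} (hx : ‖x‖ = 1) :
    ∃ E : Set Ω, MeasurableSet E ∧ 1 - 7 * Real.exp (-n) - 1 / (n : ℝ) ^ 2 ≤ P.real E ∧
      ∀ ω ∈ E, WellConditioned (fun r => a r ω) x := by
  have hn' : (10 : ℝ) ^ 6 ≤ n := by exact_mod_cast hn
  have hn0 : (0 : ℝ) < n := by linarith
  have hlog : 1 ≤ Real.log n := by
    rw [Real.le_log_iff_exp_le (by linarith)]
    linarith [Real.exp_one_lt_d9]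
  have hm1 : 10 ^ 15 * (n : ℝ) ≤ m := by nlinarith
  have hm0 : (0 : ℝ) < m := by linarith
  obtain ⟨E1, hE1, hP1, h1⟩ := ha.exists_upper hm1
  obtain ⟨E2, hE2, hP2, h2⟩ := ha.exists_weighted hn hm hx
  obtain ⟨E3, hE3, hP3, h3⟩ := ha.exists_curvature hm1 hx
  -- A single lower-tail argument serves `fourth`, `second` and `energy`, none of which needs a net.
  have lower : ∀ {X : EuclideanSpace ℂ (Fin n) → ℝ}, Measurable X → (∀ b, 0 ≤ X b) →
      Integrable X (complexGaussian n) →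
      Integrable (fun b => X b ^ 2) (complexGaussian n) → ∀ {κ V δ : ℝ}, 0 < V → 0 < δ →
      κ ≤ ∫ b, X b ∂(complexGaussian n) → ∫ b, X b ^ 2 ∂(complexGaussian n) ≤ V →
      1 / 10 ^ 15 ≤ δ ^ 2 / (2 * V) →
      ∃ E : Set Ω, MeasurableSet E ∧ P.real Eᶜ ≤ Real.exp (-n) ∧
        ∀ ω ∈ E, m * (κ - δ) ≤ ∑ r, X (a r ω) := by
    intro X hX h0 hi hi2 κ V δ hV hδ hκ hXV hδV
    refine ⟨{ω | ∑ r, X (a r ω) ≤ m * (κ - δ)}ᶜ, (measurableSet_le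
      (Finset.measurable_fun_sum _ fun r _ => hX.comp (ha.measurable r))
      measurable_const).compl, ?_, fun ω hω => (not_le.1 fun h => hω h).le⟩
    rw [compl_compl]
    refine (ha.measure_lower_tail_le hX h0 hi hκ hi2 hV hXV hδ).trans ?_
    apply Real.exp_le_exp.2
    have := mul_le_mul_of_nonneg_left hδV hm0.le
    linarith
  obtain ⟨E4, hE4, hP4, h4⟩ := lower (X := fun b => ‖inner ℂ b x‖ ^ 4) (by fun_prop)
    (fun b => by positivity) (integrable_norm_inner_pow x 4)
    (by simpa [← pow_mul] using integrable_norm_inner_pow x 8) (κ := 2) (V := 12288)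
    (δ := 1 / 1000) (by norm_num) (by norm_num) (by rw [integral_norm_inner_pow_four, hx]; norm_num)
    (by simpa [← pow_mul] using integral_norm_inner_pow_eight_le hx) (by norm_num)
  obtain ⟨E5, hE5, hP5, h5⟩ := lower (X := fun b => ‖inner ℂ b x‖ ^ 2) (by fun_prop)
    (fun b => by positivity) (integrable_norm_inner_pow x 2)
    (by simpa [← pow_mul] using integrable_norm_inner_pow x 4) (κ := 1) (V := 2)
    (δ := 1 / 1000) (by norm_num) (by norm_num) (by rw [integral_norm_inner_sq, hx]; norm_num)
    (by simp only [← pow_mul]; norm_num [integral_norm_inner_pow_four, hx]) (by norm_num)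
  obtain ⟨E6, hE6, hP6, h6⟩ := lower (X := fun b => ‖b‖ ^ 2) (by fun_prop)
    (fun b => by positivity) integral_norm_sq.1 integral_norm_pow_four_le.1 (κ := n)
    (V := 2 * n ^ 2) (δ := n / 1000) (by positivity) (by positivity) integral_norm_sq.2.ge
    integral_norm_pow_four_le.2 (by
      rw [show ((n : ℝ) / 1000) ^ 2 / (2 * (2 * n ^ 2)) = 1 / 4000000 by field_simp; norm_num]
      norm_num)
  let B : Set Ω := {ω | (m : ℝ) ≤ ∑ r, if 8 * n < ‖a r ω‖ ^ 2 then ‖a r ω‖ ^ 6 else 0}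
  have hBm : MeasurableSet B := ha.measurableSet_le_sum measurable_tail _
  have hP7 : P.real B ≤ Real.exp (-n) := by
    refine (ha.measure_le_sum_le measurable_tail (fun b => by split_ifs <;> positivity)
      integral_tail_le.1 hm0).trans ?_
    rw [mul_div_assoc, mul_comm, div_mul_cancel₀ _ hm0.ne']
    refine integral_tail_le.2.trans ?_
    have e1 : (2 : ℝ) ≤ Real.exp (7 / 10) := by
      rw [← Real.log_le_iff_le_exp (by norm_num)]
      linarith [Real.log_two_lt_d9]
    have e2 : (2 : ℝ) ^ n ≤ Real.exp (7 / 10 * n) := by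
      calc (2 : ℝ) ^ n ≤ Real.exp (7 / 10) ^ n := by gcongr
        _ = _ := by rw [← Real.exp_nat_mul]; congr 1; ring
    have e3 : (384 : ℝ) ≤ Real.exp (3 / 10 * n) := by linarith [Real.add_one_le_exp (3 / 10 * (n : ℝ))]
    calc 384 * Real.exp (-(2 * n)) * 2 ^ n
        ≤ Real.exp (3 / 10 * n) * Real.exp (-(2 * n)) * Real.exp (7 / 10 * n) := by gcongr
      _ = Real.exp (-n) := by rw [← Real.exp_add, ← Real.exp_add]; congr 1; ring
  have hE : MeasurableSet (E1 ∩ (E2 ∩ (E3 ∩ (E4 ∩ (E5 ∩ (E6 ∩ Bᶜ)))))) :=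
    hE1.inter (hE2.inter (hE3.inter (hE4.inter (hE5.inter (hE6.inter hBm.compl)))))
  refine ⟨_, hE, ?_, ?_⟩
  · have key : P.real (E1 ∩ (E2 ∩ (E3 ∩ (E4 ∩ (E5 ∩ (E6 ∩ Bᶜ))))))ᶜ ≤
        7 * Real.exp (-n) + 1 / (n : ℝ) ^ 2 := by
      simp only [Set.compl_inter, compl_compl]
      have u := fun s t : Set Ω => measureReal_union_le (μ := P) s t
      have u1 := u E1ᶜ (E2ᶜ ∪ (E3ᶜ ∪ (E4ᶜ ∪ (E5ᶜ ∪ (E6ᶜ ∪ B)))))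
      have u2 := u E2ᶜ (E3ᶜ ∪ (E4ᶜ ∪ (E5ᶜ ∪ (E6ᶜ ∪ B))))
      have u3 := u E3ᶜ (E4ᶜ ∪ (E5ᶜ ∪ (E6ᶜ ∪ B)))
      have u4 := u E4ᶜ (E5ᶜ ∪ (E6ᶜ ∪ B))
      have u5 := u E5ᶜ (E6ᶜ ∪ B)
      have u6 := u E6ᶜ B
      linarith
    rw [probReal_compl_eq_one_sub hE] at key
    linarith
  · rintro ω ⟨hω1, hω2, hω3, hω4, hω5, hω6, hω7⟩
    refine ⟨h1 ω hω1, h2 ω hω2, ?_, ?_, ?_, h3 ω hω3 (h1 ω hω1), (not_le.1 fun h => hω7 h).le⟩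
    · exact (by norm_num : (m : ℝ) * (1999 / 1000) = m * (2 - 1 / 1000)).trans_le (h4 ω hω4)
    · exact (by norm_num : (m : ℝ) * (999 / 1000) = m * (1 - 1 / 1000)).trans_le (h5 ω hω5)
    · exact (by ring : (m : ℝ) * (999 / 1000 * n) = m * (n - n / 1000)).trans_le (h6 ω hω6)

end GoodEventProbability

/-! ### Local geometry of the objective and contraction of the iterates -/

section Convergence

variable {n m : ℕ}

lemma phaseDist_le_norm_sub_smul (z x : EuclideanSpace ℂ (Fin n)) {ζ : ℂ} (hζ : ‖ζ‖ = 1) :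
    phaseDist z x ≤ ‖z - ζ • x‖ := by
  have hbdd : BddBelow (Set.range fun φ : Set.Icc (0 : ℝ) (2 * Real.pi) =>
      ‖z - Complex.exp ((φ : ℝ) * Complex.I) • x‖) :=
    ⟨0, by rintro _ ⟨φ, rfl⟩; exact norm_nonneg _⟩
  have hexp : Complex.exp (ζ.arg * Complex.I) = ζ := by
    have := Complex.norm_mul_exp_arg_mul_I ζ
    rwa [hζ, Complex.ofReal_one, one_mul] at this
  rcases le_total 0 ζ.arg with h | h
  · refine (ciInf_le hbdd ⟨ζ.arg, h, by linarith [Complex.arg_le_pi ζ, Real.pi_pos]⟩).trans_eq ?_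
    simp only [hexp]
  · refine (ciInf_le hbdd ⟨ζ.arg + 2 * Real.pi,
      by linarith [Complex.neg_pi_lt_arg ζ, Real.pi_pos], by linarith⟩).trans_eq ?_
    have e : Complex.exp ((ζ.arg + 2 * Real.pi : ℝ) * Complex.I) = ζ := by
      push_cast
      rw [add_mul, Complex.exp_add, Complex.exp_two_pi_mul_I, mul_one, hexp]
    simp only [e]

/-- The distance is attained at a phase aligning `z` with `x`. -/
lemma exists_phaseDist_eq (z x : EuclideanSpace ℂ (Fin n)) :
    ∃ ζ : ℂ, ‖ζ‖ = 1 ∧ inner ℂ (ζ • x) z = (‖inner ℂ x z‖ : ℂ) ∧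
      ‖z - ζ • x‖ = phaseDist z x := by
  obtain ⟨ζ, hζ, hin⟩ : ∃ ζ : ℂ, ‖ζ‖ = 1 ∧ inner ℂ (ζ • x) z = (‖inner ℂ x z‖ : ℂ) := by
    by_cases hs : inner ℂ x z = 0
    · exact ⟨1, by simp, by simp [hs]⟩
    · have hs' : ‖inner ℂ x z‖ ≠ 0 := norm_ne_zero_iff.2 hs
      -- The phase of x^*z maximizes Re⟨z, ζx⟩ over unit ζ, hence minimizes the distance. It also
      -- makes the inner product of ζx with z − ζx real, as the curvature condition requires.
      refine ⟨inner ℂ x z / ‖inner ℂ x z‖, by simp [hs'], ?_⟩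
      rw [inner_smul_left, map_div₀, Complex.conj_ofReal, div_mul_eq_mul_div, Complex.conj_mul']
      have : (‖inner ℂ x z‖ : ℂ) ≠ 0 := by exact_mod_cast hs'
      field_simp
  refine ⟨ζ, hζ, hin, le_antisymm ?_ (phaseDist_le_norm_sub_smul z x hζ)⟩
  have : Nonempty (Set.Icc (0 : ℝ) (2 * Real.pi)) := ⟨0, le_rfl, by positivity⟩
  refine le_ciInf fun φ => ?_
  have hφ : ‖Complex.exp ((φ : ℝ) * Complex.I)‖ = 1 := Complex.norm_exp_ofReal_mul_I _
  set c := Complex.exp ((φ : ℝ) * Complex.I)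
  rw [← abs_of_nonneg (norm_nonneg (z - ζ • x)), ← abs_of_nonneg (norm_nonneg (z - c • x)),
    ← sq_le_sq, norm_sub_sq (𝕜 := ℂ), norm_sub_sq (𝕜 := ℂ), norm_smul, norm_smul, hζ, hφ]
  have h1 : RCLike.re (inner ℂ z (ζ • x)) = ‖inner ℂ x z‖ := by
    rw [← inner_conj_symm, hin]; simp
  have h2 : RCLike.re (inner ℂ z (c • x)) ≤ ‖inner ℂ x z‖ := by
    refine (RCLike.re_le_norm _).trans ?_
    rw [inner_smul_right, norm_mul, hφ, one_mul, norm_inner_symm]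
  linarith

lemma norm_inner_smul_of_unit (b w : EuclideanSpace ℂ (Fin n)) {ζ : ℂ} (hζ : ‖ζ‖ = 1) :
    ‖inner ℂ b (ζ • w)‖ = ‖inner ℂ b w‖ := by
  rw [inner_smul_right, norm_mul, hζ, one_mul]

lemma samples_smul_of_unit (b : Fin m → EuclideanSpace ℂ (Fin n)) (x : EuclideanSpace ℂ (Fin n))
    {ζ : ℂ} (hζ : ‖ζ‖ = 1) : samples b (ζ • x) = samples b x := by
  ext r
  simp only [samples, norm_inner_smul_of_unit _ _ hζ]

/-- The conditions are invariant under a change of the phase of the signal. -/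
lemma WellConditioned.smul {b : Fin m → EuclideanSpace ℂ (Fin n)} {x : EuclideanSpace ℂ (Fin n)}
    (h : WellConditioned b x) {ζ : ℂ} (hζ : ‖ζ‖ = 1) : WellConditioned b (ζ • x) := by
  have hζ' : ‖(starRingEnd ℂ) ζ‖ = 1 := by rw [RCLike.norm_conj, hζ]
  have hin : ∀ w, inner ℂ (ζ • x) w = inner ℂ x ((starRingEnd ℂ) ζ • w) := fun w => by
    rw [inner_smul_left, inner_smul_right]
  refine ⟨h.upper, ?_, ?_, ?_, h.energy, ?_, h.tail⟩
  · intro w hw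
    have := h.weighted ((starRingEnd ℂ) ζ • w) (by rw [norm_smul, hζ', hw, one_mul])
    simpa only [hin, norm_inner_smul_of_unit _ _ hζ, norm_inner_smul_of_unit _ _ hζ'] using this
  · simpa only [norm_inner_smul_of_unit _ _ hζ] using h.fourth
  · simpa only [norm_inner_smul_of_unit _ _ hζ] using h.second
  · intro w hw him
    rw [hin] at him ⊢
    have := h.curvature ((starRingEnd ℂ) ζ • w) (by rw [norm_smul, hζ', hw, one_mul]) him
    refine this.trans_eq (Finset.sum_congr rfl fun r _ => ?_)
    have : correl (b r) x ((starRingEnd ℂ) ζ • w) = correl (b r) (ζ • x) w := by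
      simp only [correl, inner_smul_right, map_mul]; congr 1; ring
    simp only [curvGap, this, norm_inner_smul_of_unit _ _ hζ']

/-- Bessel-type bound dual to the bound of the sampling operator. -/
lemma WellConditioned.norm_sum_smul_sq_le {b : Fin m → EuclideanSpace ℂ (Fin n)}
    {x : EuclideanSpace ℂ (Fin n)} (h : WellConditioned b x) (c : Fin m → ℂ) :
    ‖∑ r, c r • b r‖ ^ 2 ≤ 1001 / 1000 * m * ∑ r, ‖c r‖ ^ 2 := by
  set G := ∑ r, c r • b r with hG
  by_cases hG0 : ‖G‖ = 0
  · rw [hG0]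
    have : 0 ≤ ∑ r, ‖c r‖ ^ 2 := Finset.sum_nonneg fun r _ => by positivity
    have : (0 : ℝ) ≤ m := by positivity
    simp only [ne_eq, OfNat.ofNat_ne_zero, not_false_eq_true, zero_pow]
    positivity
  have h1 : ‖G‖ ^ 2 ≤ ∑ r, ‖c r‖ * ‖inner ℂ (b r) G‖ := by
    have e : (‖G‖ : ℂ) ^ 2 = ∑ r, c r * inner ℂ G (b r) := by
      have := inner_self_eq_norm_sq_to_K (𝕜 := ℂ) G
      rw [← RCLike.ofReal_eq_complex_ofReal]
      rw [← this]
      conv_lhs => rw [hG, inner_sum]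
      simp only [inner_smul_right]
      rfl
    have e2 : ‖G‖ ^ 2 = ‖(‖G‖ : ℂ) ^ 2‖ := by simp
    rw [e2, e]
    refine (norm_sum_le _ _).trans (Finset.sum_le_sum fun r _ => ?_)
    rw [norm_mul, norm_inner_symm]
  have h2 := Finset.sum_mul_sq_le_sq_mul_sq Finset.univ (fun r => ‖c r‖)
    (fun r => ‖inner ℂ (b r) G‖)
  have h3 := h.upper G
  have h4 : (‖G‖ ^ 2) ^ 2 ≤ (∑ r, ‖c r‖ ^ 2) * (1001 / 1000 * m * ‖G‖ ^ 2) := by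
    calc (‖G‖ ^ 2) ^ 2 ≤ (∑ r, ‖c r‖ * ‖inner ℂ (b r) G‖) ^ 2 := by gcongr
      _ ≤ _ := h2
      _ ≤ _ := by gcongr
  have h5 : 0 < ‖G‖ ^ 2 := by positivity
  have h6 : ‖G‖ ^ 2 * ‖G‖ ^ 2 ≤ (1001 / 1000 * m * ∑ r, ‖c r‖ ^ 2) * ‖G‖ ^ 2 := by linarith
  exact le_of_mul_le_mul_right h6 h5

lemma norm_inner_add_sq_sub (b x h : EuclideanSpace ℂ (Fin n)) :
    ‖inner ℂ b (x + h)‖ ^ 2 - ‖inner ℂ b x‖ ^ 2 = 2 * correl b x h + ‖inner ℂ b h‖ ^ 2 := by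
  rw [inner_add_right, correl]
  simp only [Complex.sq_norm, Complex.normSq_apply, Complex.add_re, Complex.add_im, Complex.mul_re,
    Complex.conj_re, Complex.conj_im]
  ring

lemma grad_add_eq (b : Fin m → EuclideanSpace ℂ (Fin n)) (x h : EuclideanSpace ℂ (Fin n)) :
    grad b (samples b x) (x + h) = (1 / (m : ℂ)) • ∑ r,
      (((2 * correl (b r) x h + ‖inner ℂ (b r) h‖ ^ 2 : ℝ) : ℂ) * inner ℂ (b r) (x + h)) • b r := by
  simp only [grad, samples, norm_inner_add_sq_sub, smul_smul]

/-- With R = `correl` and q = |b^*h|², the residual is 2R + q and conj(b^*h) b^*(x + h) has real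
part R + q. -/
lemma re_inner_grad (b : Fin m → EuclideanSpace ℂ (Fin n)) (hm : 0 < m)
    (x h : EuclideanSpace ℂ (Fin n)) :
    m * (inner ℂ h (grad b (samples b x) (x + h))).re =
      ∑ r, (2 * correl (b r) x h + ‖inner ℂ (b r) h‖ ^ 2) *
        (correl (b r) x h + ‖inner ℂ (b r) h‖ ^ 2) := by
  have hm' : (m : ℂ) ≠ 0 := by exact_mod_cast hm.ne'
  have e : (m : ℂ) * inner ℂ h (grad b (samples b x) (x + h)) = ∑ r,
      ((2 * correl (b r) x h + ‖inner ℂ (b r) h‖ ^ 2 : ℝ) : ℂ) *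
        (inner ℂ (b r) (x + h) * inner ℂ h (b r)) := by
    rw [grad_add_eq, inner_smul_right, ← mul_assoc, mul_one_div_cancel hm', one_mul, inner_sum]
    refine Finset.sum_congr rfl fun r _ => ?_
    rw [inner_smul_right, mul_assoc]
  have e2 : m * (inner ℂ h (grad b (samples b x) (x + h))).re =
      ((m : ℂ) * inner ℂ h (grad b (samples b x) (x + h))).re := by
    rw [← Complex.ofReal_natCast, Complex.re_ofReal_mul]
  rw [e2, e, Complex.re_sum]
  refine Finset.sum_congr rfl fun r _ => ?_
  rw [Complex.re_ofReal_mul]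
  congr 1
  rw [← inner_conj_symm h (b r), inner_add_right, correl]
  simp only [Complex.sq_norm, Complex.normSq_apply, Complex.add_re, Complex.add_im, Complex.mul_re,
    Complex.conj_re, Complex.conj_im]
  ring

lemma correl_smul (b x w : EuclideanSpace ℂ (Fin n)) (t : ℝ) :
    correl b x ((t : ℂ) • w) = t * correl b x w := by
  rw [correl, inner_smul_right, mul_left_comm, Complex.re_ofReal_mul, correl]

lemma exists_unit_smul {h : EuclideanSpace ℂ (Fin n)} (hh : h ≠ 0) :
    ∃ w, ‖w‖ = 1 ∧ h = (‖h‖ : ℂ) • w := by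
  have hw' : ‖h‖ ≠ 0 := norm_ne_zero_iff.2 hh
  refine ⟨((‖h‖⁻¹ : ℝ) : ℂ) • h, ?_, ?_⟩
  · rw [norm_smul, Complex.norm_real, norm_inv, norm_norm, inv_mul_cancel₀ hw']
  · rw [smul_smul, ← Complex.ofReal_mul, mul_inv_cancel₀ hw']; simp

lemma WellConditioned.sum_correl_sq_le {b : Fin m → EuclideanSpace ℂ (Fin n)}
    {x : EuclideanSpace ℂ (Fin n)} (hb : WellConditioned b x) {w : EuclideanSpace ℂ (Fin n)}
    (hw : ‖w‖ = 1) : ∑ r, correl (b r) x w ^ 2 ≤ m * (1001 / 1000 + ‖inner ℂ x w‖ ^ 2) :=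
  (Finset.sum_le_sum fun r _ => correl_sq_le (b r) x w).trans (hb.weighted w hw)

/-- Local curvature of the objective around the signal. -/
lemma WellConditioned.local_curvature {b : Fin m → EuclideanSpace ℂ (Fin n)}
    {x : EuclideanSpace ℂ (Fin n)} (hb : WellConditioned b x) {h : EuclideanSpace ℂ (Fin n)}
    (hh : ‖h‖ ≤ 1 / 8) (him : (inner ℂ x h).im = 0) :
    23 / 100 * (m * ‖h‖ ^ 2) + 31 / 256 * ∑ r, (‖inner ℂ (b r) h‖ ^ 2) ^ 2 ≤
      ∑ r, (2 * correl (b r) x h + ‖inner ℂ (b r) h‖ ^ 2) *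
        (correl (b r) x h + ‖inner ℂ (b r) h‖ ^ 2) := by
  by_cases hh0 : h = 0
  · subst hh0; simp [correl]
  obtain ⟨w, hw, hhw⟩ := exists_unit_smul hh0
  have ht : 0 < ‖h‖ := norm_pos_iff.2 hh0
  set t := ‖h‖
  have himw : (inner ℂ x w).im = 0 := by
    rw [hhw, inner_smul_right, Complex.im_ofReal_mul] at him
    exact (mul_eq_zero.1 him).resolve_left ht.ne'
  have hR : ∀ r, correl (b r) x h = t * correl (b r) x w := fun r => by rw [hhw, correl_smul]
  have hq : ∀ r, ‖inner ℂ (b r) h‖ ^ 2 = t ^ 2 * ‖inner ℂ (b r) w‖ ^ 2 := fun r => by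
    rw [hhw, inner_smul_right, norm_mul, Complex.norm_real, Real.norm_of_nonneg ht.le, mul_pow]
  -- Completing the square: 2·(8/5)·(15/16) = 3 is the coefficient of the cross term, and the
  -- remainders are 2 − 64/25 = −56/100 and 1 − 225/256 = 31/256. The bound t ≤ 1/8 then removes t
  -- from the square.
  have hterm : ∀ r, t ^ 2 * curvGap (b r) x w ^ 2 - 56 / 100 * (t ^ 2 * correl (b r) x w ^ 2) +
      31 / 256 * (‖inner ℂ (b r) h‖ ^ 2) ^ 2 ≤
      (2 * correl (b r) x h + ‖inner ℂ (b r) h‖ ^ 2) *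
        (correl (b r) x h + ‖inner ℂ (b r) h‖ ^ 2) := by
    intro r
    rw [hq, hR]
    set R := correl (b r) x w with hRdef
    set q := ‖inner ℂ (b r) w‖ ^ 2 with hqdef
    have hq0 : 0 ≤ q := by positivity
    have hg : curvGap (b r) x w ^ 2 ≤ (8 / 5 * R + 15 / 16 * (t * q)) ^ 2 := by
      rw [← sq_abs (8 / 5 * R + 15 / 16 * (t * q))]
      have h1 : curvGap (b r) x w ≤ |8 / 5 * R + 15 / 16 * (t * q)| := by
        refine max_le (abs_nonneg _) ?_
        have h2 : t * q ≤ 1 / 8 * q := by gcongr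
        have h3 : |8 / 5 * R| ≤ |8 / 5 * R + 15 / 16 * (t * q)| + |15 / 16 * (t * q)| := by
          have := abs_sub (8 / 5 * R + 15 / 16 * (t * q)) (15 / 16 * (t * q))
          rwa [add_sub_cancel_right] at this
        rw [abs_mul, abs_of_pos (by norm_num : (0 : ℝ) < 8 / 5),
          abs_of_nonneg (by positivity : 0 ≤ 15 / 16 * (t * q))] at h3
        linarith
      have := curvGap_nonneg (b r) x w
      gcongr
    have := mul_le_mul_of_nonneg_left hg (sq_nonneg t)
    linarith
  have hsum := Finset.sum_le_sum fun r (_ : r ∈ Finset.univ) => hterm r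
  rw [Finset.sum_add_distrib, Finset.sum_sub_distrib, ← Finset.mul_sum, ← Finset.mul_sum,
    ← Finset.mul_sum, ← Finset.mul_sum] at hsum
  have h1 := hb.curvature w hw himw
  have h2 := hb.sum_correl_sq_le hw
  have e : ‖inner ℂ x w‖ ^ 2 = (inner ℂ x w).re ^ 2 := by
    rw [Complex.sq_norm, Complex.normSq_apply, himw]; ring
  rw [e] at h2
  have h3 := mul_le_mul_of_nonneg_left h1 (sq_nonneg t)
  have h4 := mul_le_mul_of_nonneg_left h2 (sq_nonneg t)
  have h5 : 0 ≤ t ^ 2 * (m * (inner ℂ x w).re ^ 2) := by positivity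
  have h6 : 0 ≤ t ^ 2 * (m : ℝ) := by positivity
  -- Here 4/5 − 0.56·1.001 > 23/100, and 3/5 > 56/100 disposes of the Re² terms.
  linarith

/-- Local smoothness of the objective around the signal. -/
lemma WellConditioned.local_smoothness {b : Fin m → EuclideanSpace ℂ (Fin n)}
    {x : EuclideanSpace ℂ (Fin n)} (hb : WellConditioned b x) (hx : ‖x‖ = 1) (hn : 0 < n)
    {h : EuclideanSpace ℂ (Fin n)} (hh : ‖h‖ ≤ 1 / 8) :
    ‖(m : ℂ) • grad b (samples b x) (x + h)‖ ^ 2 ≤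
      300 * n * m * (m * ‖h‖ ^ 2 + ∑ r, (‖inner ℂ (b r) h‖ ^ 2) ^ 2) := by
  rcases Nat.eq_zero_or_pos m with rfl | hm
  · simp
  have hm' : (m : ℂ) ≠ 0 := by exact_mod_cast hm.ne'
  have hn1 : (1 : ℝ) ≤ n := by exact_mod_cast hn
  rw [grad_add_eq, smul_smul, mul_one_div_cancel hm', one_smul]
  refine (hb.norm_sum_smul_sq_le _).trans ?_
  have hz : ‖x + h‖ ^ 2 ≤ 2 := by
    have : ‖x + h‖ ≤ 9 / 8 := (norm_add_le _ _).trans (by rw [hx]; linarith)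
    nlinarith [norm_nonneg (x + h)]
  have hin : ∀ r w, ‖inner ℂ (b r) w‖ ^ 2 ≤ ‖b r‖ ^ 2 * ‖w‖ ^ 2 := fun r w => by
    rw [← mul_pow]
    have := norm_inner_le_norm (𝕜 := ℂ) (b r) w
    gcongr
  -- Vectors with ‖b‖² ≤ 8n satisfy |b^*(x + h)|² ≤ 16n; for the rest every factor is bounded by a
  -- power of ‖b‖, leaving ‖b‖⁶‖h‖².
  have hterm : ∀ r, ‖(((2 * correl (b r) x h + ‖inner ℂ (b r) h‖ ^ 2 : ℝ) : ℂ) *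
      inner ℂ (b r) (x + h))‖ ^ 2 ≤
      16 * n * (8 * correl (b r) x h ^ 2 + 2 * (‖inner ℂ (b r) h‖ ^ 2) ^ 2) +
      17 * ‖h‖ ^ 2 * (if 8 * n < ‖b r‖ ^ 2 then ‖b r‖ ^ 6 else 0) := by
    intro r
    rw [norm_mul, mul_pow, Complex.norm_real, Real.norm_eq_abs, sq_abs]
    have hz' : ‖inner ℂ (b r) (x + h)‖ ^ 2 ≤ 2 * ‖b r‖ ^ 2 := by
      have := hin r (x + h)
      nlinarith [sq_nonneg ‖b r‖]
    have hq := hin r h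
    have hRR : correl (b r) x h ^ 2 ≤ ‖b r‖ ^ 2 * (‖b r‖ ^ 2 * ‖h‖ ^ 2) := by
      refine (correl_sq_le (b r) x h).trans ?_
      have := hin r x
      rw [hx, one_pow, mul_one] at this
      gcongr
    set R := correl (b r) x h
    set q := ‖inner ℂ (b r) h‖ ^ 2
    have hq0 : 0 ≤ q := by positivity
    have h1 : (2 * R + q) ^ 2 ≤ 8 * R ^ 2 + 2 * q ^ 2 := by nlinarith [sq_nonneg (2 * R - q)]
    have h2 : (2 * R + q) ^ 2 * ‖inner ℂ (b r) (x + h)‖ ^ 2 ≤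
      (8 * R ^ 2 + 2 * q ^ 2) * (2 * ‖b r‖ ^ 2) := by gcongr
    refine h2.trans ?_
    split_ifs with hc
    · have h3 : q ^ 2 ≤ ‖b r‖ ^ 2 * (‖b r‖ ^ 2 * ‖h‖ ^ 2) * (1 / 64) := by
        have h4 : ‖h‖ ^ 2 ≤ 1 / 64 := by nlinarith [norm_nonneg h]
        calc q ^ 2 ≤ (‖b r‖ ^ 2 * ‖h‖ ^ 2) ^ 2 := by gcongr
          _ = ‖b r‖ ^ 2 * (‖b r‖ ^ 2 * ‖h‖ ^ 2) * ‖h‖ ^ 2 := by ring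
          _ ≤ _ := by gcongr
      have h5 : (8 * R ^ 2 + 2 * q ^ 2) * (2 * ‖b r‖ ^ 2) ≤
          (17 / 2 * (‖b r‖ ^ 2 * (‖b r‖ ^ 2 * ‖h‖ ^ 2))) * (2 * ‖b r‖ ^ 2) := by
        have : 0 ≤ ‖b r‖ ^ 2 * (‖b r‖ ^ 2 * ‖h‖ ^ 2) := by positivity
        gcongr
        linarith
      have h6 : 0 ≤ 16 * (n : ℝ) * (8 * R ^ 2 + 2 * q ^ 2) := by positivity
      linarith
    · have h3 : 2 * ‖b r‖ ^ 2 ≤ 16 * n := by linarith [not_lt.1 hc]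
      have h4 : (8 * R ^ 2 + 2 * q ^ 2) * (2 * ‖b r‖ ^ 2) ≤
        (8 * R ^ 2 + 2 * q ^ 2) * (16 * n) := by gcongr
      linarith
  have hsum := Finset.sum_le_sum fun r (_ : r ∈ Finset.univ) => hterm r
  rw [Finset.sum_add_distrib, ← Finset.mul_sum, ← Finset.mul_sum, Finset.sum_add_distrib,
    ← Finset.mul_sum, ← Finset.mul_sum] at hsum
  have hR : ∑ r, correl (b r) x h ^ 2 ≤ 2001 / 1000 * (m * ‖h‖ ^ 2) := by
    by_cases hh0 : h = 0
    · subst hh0; simp [correl]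
    obtain ⟨w, hw, hhw⟩ := exists_unit_smul hh0
    have e : ∀ r, correl (b r) x h ^ 2 = ‖h‖ ^ 2 * correl (b r) x w ^ 2 := fun r => by
      rw [← mul_pow, ← correl_smul, ← hhw]
    simp only [e, ← Finset.mul_sum]
    have h1 := hb.sum_correl_sq_le hw
    have h2 : ‖inner ℂ x w‖ ^ 2 ≤ 1 := pow_le_one₀ (norm_nonneg _) (by
      simpa [hx, hw] using norm_inner_le_norm (𝕜 := ℂ) x w)
    have h3 : ∑ r, correl (b r) x w ^ 2 ≤ m * (2001 / 1000 : ℝ) := h1.trans (by gcongr; linarith)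
    calc ‖h‖ ^ 2 * ∑ r, correl (b r) x w ^ 2 ≤ ‖h‖ ^ 2 * (m * (2001 / 1000 : ℝ)) := by gcongr
      _ = _ := by ring
  have ht := hb.tail
  set S := ∑ r, (‖inner ℂ (b r) h‖ ^ 2) ^ 2
  have hS : 0 ≤ S := Finset.sum_nonneg fun r _ => by positivity
  set A := (m : ℝ) * ‖h‖ ^ 2 with hA
  have hA0 : 0 ≤ A := by positivity
  have h1 : 17 * ‖h‖ ^ 2 * ∑ r, (if 8 * n < ‖b r‖ ^ 2 then ‖b r‖ ^ 6 else 0) ≤ 17 * (n * A) := by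
    calc _ ≤ 17 * ‖h‖ ^ 2 * m := by gcongr
      _ = 17 * (1 * A) := by rw [hA]; ring
      _ ≤ _ := by gcongr
  have h2 : 16 * (n : ℝ) * (8 * ∑ r, correl (b r) x h ^ 2 + 2 * S) ≤
      16 * n * (8 * (2001 / 1000 * A) + 2 * S) := by gcongr
  have h3 : ∑ r, ‖(((2 * correl (b r) x h + ‖inner ℂ (b r) h‖ ^ 2 : ℝ) : ℂ) *
      inner ℂ (b r) (x + h))‖ ^ 2 ≤ 280 * (n * (A + S)) := by
    have : 0 ≤ (n : ℝ) * S := by positivity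
    have : 0 ≤ (n : ℝ) * A := by positivity
    linarith
  calc _ ≤ 1001 / 1000 * (m : ℝ) * (280 * (n * (A + S))) := by gcongr
    _ ≤ _ := by
      have : 0 ≤ (m : ℝ) * (n * (A + S)) := by positivity
      linarith

/-- One step of gradient descent contracts the distance to the signal. -/
lemma WellConditioned.norm_sub_smul_grad_sq_le {b : Fin m → EuclideanSpace ℂ (Fin n)}
    {x : EuclideanSpace ℂ (Fin n)} (hb : WellConditioned b x) (hx : ‖x‖ = 1) (hn : 0 < n)
    (hm : 0 < m) {h : EuclideanSpace ℂ (Fin n)} (hh : ‖h‖ ≤ 1 / 8) (him : (inner ℂ x h).im = 0)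
    {η : ℝ} (hη : 0 ≤ η) (hηn : η * n ≤ 1 / 3000) :
    ‖h - (η : ℂ) • grad b (samples b x) (x + h)‖ ^ 2 ≤ (1 - 81 / 256 * η) * ‖h‖ ^ 2 := by
  have hc := hb.local_curvature hh him
  have hs := hb.local_smoothness hx hn hh
  rw [← re_inner_grad b hm] at hc
  set D := grad b (samples b x) (x + h)
  rw [norm_smul, mul_pow, Complex.norm_natCast] at hs
  rw [norm_sub_sq (𝕜 := ℂ), inner_smul_right, norm_smul, Complex.norm_real,
    Real.norm_of_nonneg hη]
  have e : RCLike.re ((η : ℂ) * inner ℂ h D) = η * (inner ℂ h D).re := Complex.re_ofReal_mul _ _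
  rw [e]
  set S := ∑ r, (‖inner ℂ (b r) h‖ ^ 2) ^ 2
  have hS : 0 ≤ S := Finset.sum_nonneg fun r _ => by positivity
  have hm0 : (0 : ℝ) < m := by exact_mod_cast hm
  set I := (inner ℂ h D).re
  -- The step size η ≤ 1/(3000n) cancels the n in the smoothness bound and leaves the factor 1/10.
  -- This is beaten in both terms by twice the curvature: 46/100 − 1/10 > 81/256 for ‖h‖², and
  -- 62/256 > 1/10 for S.
  have h1 : η ^ 2 * ((m : ℝ) ^ 2 * ‖D‖ ^ 2) ≤ η * m * (1 / 10 * (m * ‖h‖ ^ 2 + S)) := by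
    have h2 : 0 ≤ η * m * (m * ‖h‖ ^ 2 + S) := by positivity
    calc η ^ 2 * ((m : ℝ) ^ 2 * ‖D‖ ^ 2) ≤ η ^ 2 * (300 * n * m * (m * ‖h‖ ^ 2 + S)) := by gcongr
      _ = (η * n) * (300 * (η * m * (m * ‖h‖ ^ 2 + S))) := by ring
      _ ≤ 1 / 3000 * (300 * (η * m * (m * ‖h‖ ^ 2 + S))) := by gcongr
      _ = _ := by ring
  have h3 : 2 * η * m * (23 / 100 * (m * ‖h‖ ^ 2) + 31 / 256 * S) ≤ 2 * η * m * (m * I) := by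
    gcongr
  have h4 : 0 ≤ η * m * S := by positivity
  have h5 : 0 ≤ η * (m * (m * ‖h‖ ^ 2)) := by positivity
  have h6 : (m : ℝ) ^ 2 * (‖h‖ ^ 2 - 2 * (η * I) + (η * ‖D‖) ^ 2) ≤
      (m : ℝ) ^ 2 * ((1 - 81 / 256 * η) * ‖h‖ ^ 2) := by linarith
  exact le_of_mul_le_mul_left h6 (by positivity)

/-- Geometric convergence of Wirtinger flow for a unit signal. -/
lemma WellConditioned.phaseDist_iterate_le {b : Fin m → EuclideanSpace ℂ (Fin n)}
    {x : EuclideanSpace ℂ (Fin n)} (hb : WellConditioned b x) (hx : ‖x‖ = 1) (hn : 0 < n)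
    (hm : 0 < m) {μ : ℝ} (hμ : 0 < μ) (hμn : μ ≤ 1 / 10000 / n) {z₀ : EuclideanSpace ℂ (Fin n)}
    (hz₀ : phaseDist z₀ x ≤ 1 / 8) (τ : ℕ) :
    phaseDist (iterate b (samples b x) (fun _ => μ) z₀ τ) x ≤
      1 / 8 * (1 - μ / 4) ^ ((τ : ℝ) / 2) := by
  have hn1 : (1 : ℝ) ≤ n := by exact_mod_cast hn
  have hμ1 : μ ≤ 1 / 10000 := hμn.trans (div_le_self (by norm_num) hn1)
  have hρ : 0 < 1 - μ / 4 := by linarith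
  obtain ⟨ζ₀, hζ₀, -, hd₀⟩ := exists_phaseDist_eq z₀ x
  rw [← hd₀] at hz₀
  have hζx : ‖ζ₀ • x‖ = 1 := by rw [norm_smul, hζ₀, hx, one_mul]
  have hz1 : 7 / 8 ≤ ‖z₀‖ := by
    have := norm_sub_norm_le (ζ₀ • x) z₀
    rw [norm_sub_rev, hζx] at this
    linarith
  have hz2 : ‖z₀‖ ≤ 9 / 8 := by
    have := norm_sub_norm_le z₀ (ζ₀ • x)
    rw [hζx] at this
    linarith
  have hz3 : 49 / 64 ≤ ‖z₀‖ ^ 2 := by nlinarith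
  have hz4 : ‖z₀‖ ^ 2 ≤ 81 / 64 := by nlinarith
  set η := μ / ‖z₀‖ ^ 2 with hη
  have hη0 : 0 ≤ η := by positivity
  have hημ : μ = η * ‖z₀‖ ^ 2 := by rw [hη]; field_simp
  have hηn : η * n ≤ 1 / 3000 := by
    rw [le_div_iff₀ (by linarith)] at hμn
    have : η * n * (49 / 64) ≤ 1 / 10000 := by
      calc η * n * (49 / 64) ≤ η * n * ‖z₀‖ ^ 2 := by gcongr
        _ = μ * n := by rw [hημ]; ring
        _ ≤ _ := hμn
    linarith
  -- The constant 81/256 is a quarter of 81/64, the largest possible ‖z₀‖².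
  have hημ' : 1 - 81 / 256 * η ≤ 1 - μ / 4 := by
    have : η * ‖z₀‖ ^ 2 ≤ η * (81 / 64) := by gcongr
    linarith
  induction τ with
  | zero =>
    rw [hd₀] at hz₀
    simpa [iterate] using hz₀
  | succ τ ih =>
    rw [iterate]
    set z := iterate b (samples b x) (fun _ => μ) z₀ τ
    -- The aligning phase is chosen anew at each step; the conditions and the samples do not depend
    -- on it.
    obtain ⟨ζ, hζ, hin, hd⟩ := exists_phaseDist_eq z x
    rw [← hd] at ih
    have hρτ : (1 - μ / 4) ^ ((τ : ℝ) / 2) ≤ 1 :=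
      Real.rpow_le_one hρ.le (by linarith) (by positivity)
    have hζx' : ‖ζ • x‖ = 1 := by rw [norm_smul, hζ, hx, one_mul]
    have him : (inner ℂ (ζ • x) (z - ζ • x)).im = 0 := by
      rw [inner_sub_right, hin, inner_self_eq_norm_sq_to_K, hζx']; simp
    have hstep := (hb.smul hζ).norm_sub_smul_grad_sq_le hζx' hn hm (h := z - ζ • x)
      (ih.trans (by linarith)) him hη0 hηn
    rw [samples_smul_of_unit b x hζ, add_sub_cancel] at hstep
    refine (phaseDist_le_norm_sub_smul _ x hζ).trans ?_
    rw [sub_right_comm]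
    have e : (1 - μ / 4) ^ (((τ + 1 : ℕ) : ℝ) / 2) =
        (1 - μ / 4) ^ ((τ : ℝ) / 2) * Real.sqrt (1 - μ / 4) := by
      rw [Real.sqrt_eq_rpow, ← Real.rpow_add hρ]; congr 1; push_cast; ring
    rw [e]
    refine le_of_sq_le_sq ?_ (by positivity)
    calc _ ≤ (1 - 81 / 256 * η) * ‖z - ζ • x‖ ^ 2 := hstep
      _ ≤ (1 - μ / 4) * (1 / 8 * (1 - μ / 4) ^ ((τ : ℝ) / 2)) ^ 2 := by gcongr
      _ = _ := by rw [← mul_assoc, mul_pow _ (Real.sqrt _), Real.sq_sqrt hρ.le]; ring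

end Convergence

/-! ### Spectral initialization and reduction to a unit signal -/

section Initialization

variable {n m : ℕ}

lemma isSymmetric_spectralOp (b : Fin m → EuclideanSpace ℂ (Fin n)) (y : Fin m → ℝ) :
    (spectralOp b y : Module.End ℂ (EuclideanSpace ℂ (Fin n))).IsSymmetric := by
  intro w z
  simp only [spectralOp, ContinuousLinearMap.coe_coe, smul_apply, _root_.sum_apply,
    InnerProductSpace.rankOne_apply, inner_smul_left, inner_smul_right, sum_inner, inner_sum,
    map_div₀, map_one, map_natCast, Complex.conj_ofReal, inner_conj_symm]
  congr 1
  exact Finset.sum_congr rfl fun r _ => by ring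

lemma re_inner_spectralOp (b : Fin m → EuclideanSpace ℂ (Fin n)) (y : Fin m → ℝ)
    (w : EuclideanSpace ℂ (Fin n)) :
    (inner ℂ (spectralOp b y w) w).re = 1 / m * ∑ r, y r * ‖inner ℂ (b r) w‖ ^ 2 := by
  have : inner ℂ (spectralOp b y w) w =
      ((1 / m * ∑ r, y r * ‖inner ℂ (b r) w‖ ^ 2 : ℝ) : ℂ) := by
    simp only [spectralOp, smul_apply, _root_.sum_apply,
      InnerProductSpace.rankOne_apply, inner_smul_left, sum_inner,
      map_div₀, map_one, map_natCast, Complex.conj_ofReal]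
    push_cast
    congr 1
    refine Finset.sum_congr rfl fun r _ => ?_
    rw [Complex.conj_mul']
  rw [this, Complex.ofReal_re]

/-- Leading eigenvectors maximize the quadratic form. -/
lemma IsSpectralInit.exists_maximizer {b : Fin m → EuclideanSpace ℂ (Fin n)} {y : Fin m → ℝ} {s : ℝ}
    {z₀ : EuclideanSpace ℂ (Fin n)} (hm : 0 < m) (h : IsSpectralInit b y s z₀) :
    ∃ v, ‖v‖ = 1 ∧ z₀ = (s : ℂ) • v ∧ ∀ w, ‖w‖ = 1 →
      ∑ r, y r * ‖inner ℂ (b r) w‖ ^ 2 ≤ ∑ r, y r * ‖inner ℂ (b r) v‖ ^ 2 := by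
  obtain ⟨t, v, ht, hv, hv1, hz⟩ := h
  refine ⟨v, hv1, hz, fun w hw => ?_⟩
  have hm0 : (0 : ℝ) < 1 / m := by positivity
  have hnt : Nontrivial (EuclideanSpace ℂ (Fin n)) :=
    ⟨v, 0, fun h0 => by rw [h0, norm_zero] at hv1; exact zero_ne_one hv1⟩
  -- The supremum of the Rayleigh quotient is an eigenvalue, hence at most the largest one t.
  have hsup := ht.2 (isSymmetric_spectralOp b y).hasEigenvalue_iSup_of_finiteDimensional
  have hbdd : BddAbove (Set.range fun w : {w : EuclideanSpace ℂ (Fin n) // w ≠ 0} =>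
      RCLike.re (inner ℂ ((spectralOp b y : Module.End ℂ (EuclideanSpace ℂ (Fin n))) w) w.1) /
        ‖w.1‖ ^ 2) := by
    refine ⟨‖spectralOp b y‖, ?_⟩
    rintro _ ⟨w, rfl⟩
    exact (le_abs_self _).trans ((spectralOp b y).rayleighQuotient_le_norm w)
  have hw0 : w ≠ 0 := fun h0 => by rw [h0, norm_zero] at hw; exact zero_ne_one hw
  have h1 := (le_ciSup hbdd ⟨w, hw0⟩).trans hsup
  have h2 : RCLike.re (inner ℂ (spectralOp b y w) w) / ‖w‖ ^ 2 ≤ t := h1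
  rw [hw, one_pow, div_one] at h2
  have h3 : (inner ℂ (spectralOp b y v) v).re = t := by
    have : spectralOp b y v = (t : ℂ) • v := hv.apply_eq_smul
    rw [this, inner_smul_left, inner_self_eq_norm_sq_to_K, hv1]
    simp
  rw [re_inner_spectralOp] at h3
  have h4 : (inner ℂ (spectralOp b y w) w).re ≤ t := h2
  rw [re_inner_spectralOp, ← h3] at h4
  exact le_of_mul_le_mul_left h4 hm0

lemma phaseDist_smul_smul_le {c : ℝ} (hc : 0 ≤ c) (z x : EuclideanSpace ℂ (Fin n)) :
    phaseDist ((c : ℂ) • z) ((c : ℂ) • x) ≤ c * phaseDist z x := by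
  obtain ⟨ζ, hζ, -, hd⟩ := exists_phaseDist_eq z x
  refine (phaseDist_le_norm_sub_smul _ _ hζ).trans_eq ?_
  rw [smul_comm, ← smul_sub, norm_smul, Complex.norm_real, Real.norm_of_nonneg hc, hd]

lemma samples_smul (b : Fin m → EuclideanSpace ℂ (Fin n)) (x : EuclideanSpace ℂ (Fin n)) (c : ℝ)
    (r : Fin m) : samples b ((c : ℂ) • x) r = c ^ 2 * samples b x r := by
  simp only [samples]
  rw [inner_smul_right, norm_mul, mul_pow, Complex.norm_real, Real.norm_eq_abs, sq_abs]

/-- Vectors which do at least as well as the signal in the spectral problem are close to it. -/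
lemma WellConditioned.phaseDist_smul_le {b : Fin m → EuclideanSpace ℂ (Fin n)}
    {x : EuclideanSpace ℂ (Fin n)} (hb : WellConditioned b x) (hm : 0 < m) (hx : ‖x‖ = 1)
    {v : EuclideanSpace ℂ (Fin n)} (hv : ‖v‖ = 1)
    (hmax : ∑ r, samples b x r * ‖inner ℂ (b r) x‖ ^ 2 ≤
      ∑ r, samples b x r * ‖inner ℂ (b r) v‖ ^ 2)
    {q : ℝ} (hq1 : 99 / 100 ≤ q) (hq2 : q ≤ 101 / 100) :
    phaseDist ((Real.sqrt q : ℂ) • v) x ≤ 1 / 8 := by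
  have hm0 : (0 : ℝ) < m := by exact_mod_cast hm
  have h1 := hb.fourth
  have h2 := hb.weighted v hv
  have e : ∑ r, samples b x r * ‖inner ℂ (b r) x‖ ^ 2 = ∑ r, ‖inner ℂ (b r) x‖ ^ 4 :=
    Finset.sum_congr rfl fun r _ => by simp only [samples]; ring
  rw [e] at hmax
  have h3 : m * (1999 / 1000 : ℝ) ≤ m * (1001 / 1000 + ‖inner ℂ x v‖ ^ 2) :=
    h1.trans (hmax.trans h2)
  have h4 := le_of_mul_le_mul_left h3 hm0
  have hk1 : ‖inner ℂ x v‖ ≤ 1 := by simpa [hx, hv] using norm_inner_le_norm (𝕜 := ℂ) x v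
  set k := ‖inner ℂ x v‖ with hk
  -- From k² ≥ 998/1000 and 0 ≤ k ≤ 1. The squared distance is (1 − s)² + 2s(1 − k), well below
  -- 1/64.
  have hk2 : 998 / 1000 ≤ k := by nlinarith [norm_nonneg (inner ℂ x v)]
  have hs1 : 99 / 100 ≤ Real.sqrt q := Real.le_sqrt_of_sq_le (by linarith)
  have hs2 : Real.sqrt q ≤ 101 / 100 := Real.sqrt_le_iff.2 ⟨by norm_num, by linarith⟩
  set s := Real.sqrt q
  have hs0 : 0 ≤ s := by linarith
  obtain ⟨ζ, hζ, hin, hd⟩ := exists_phaseDist_eq ((s : ℂ) • v) x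
  rw [← hd]
  refine le_of_sq_le_sq ?_ (by norm_num)
  rw [norm_sub_sq (𝕜 := ℂ), ← inner_conj_symm, hin, inner_smul_right, norm_mul, norm_smul,
    norm_smul, hζ, hx, hv, Complex.norm_real, Real.norm_of_nonneg hs0, ← hk]
  have : RCLike.re ((starRingEnd ℂ) ((s * k : ℝ) : ℂ)) = s * k := by simp
  rw [this]
  nlinarith

/-- Sum the operator bound over an orthonormal basis. With `energy` it controls the second
normalization from both sides. -/
lemma WellConditioned.energy_le {b : Fin m → EuclideanSpace ℂ (Fin n)}
    {x : EuclideanSpace ℂ (Fin n)} (hb : WellConditioned b x) :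
    ∑ r, ‖b r‖ ^ 2 ≤ m * (1001 / 1000 * n) := by
  simp_rw [norm_sq_eq_sum_inner]
  rw [Finset.sum_comm]
  refine (Finset.sum_le_sum (s := Finset.univ) fun j _ =>
    hb.upper (EuclideanSpace.basisFun (Fin n) ℂ j)).trans_eq ?_
  simp
  ring

/-- Spectral initialization succeeds for any admissible normalization. -/
lemma WellConditioned.phaseDist_spectralInit_le {b : Fin m → EuclideanSpace ℂ (Fin n)}
    {x : EuclideanSpace ℂ (Fin n)} (hb : WellConditioned b x) (hm : 0 < m) (hx : ‖x‖ = 1) {c : ℝ}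
    (hc : 0 < c) {s q : ℝ} (hs : s = Real.sqrt (c ^ 2 * q)) (hq1 : 99 / 100 ≤ q)
    (hq2 : q ≤ 101 / 100) {z₀ : EuclideanSpace ℂ (Fin n)}
    (h : IsSpectralInit b (samples b ((c : ℂ) • x)) s z₀) :
    phaseDist z₀ ((c : ℂ) • x) ≤ 1 / 8 * ‖(c : ℂ) • x‖ := by
  obtain ⟨v, hv, rfl, hmax⟩ := h.exists_maximizer hm
  have hmax' := hmax x hx
  simp only [samples_smul, mul_assoc, ← Finset.mul_sum] at hmax'
  have h1 := hb.phaseDist_smul_le hm hx hv (le_of_mul_le_mul_left hmax' (by positivity)) hq1 hq2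
  rw [Real.sqrt_mul (by positivity), Real.sqrt_sq hc.le] at hs
  rw [hs, Complex.ofReal_mul, mul_smul, norm_smul, hx, Complex.norm_real,
    Real.norm_of_nonneg hc.le]
  refine (phaseDist_smul_smul_le hc.le _ _).trans ?_
  exact (mul_le_mul_of_nonneg_left h1 hc.le).trans_eq (by ring)

lemma WellConditioned.mean_samples {b : Fin m → EuclideanSpace ℂ (Fin n)}
    {x : EuclideanSpace ℂ (Fin n)} (hb : WellConditioned b x) (hx : ‖x‖ = 1) :
    m * (999 / 1000) ≤ ∑ r, samples b x r ∧ ∑ r, samples b x r ≤ m * (1001 / 1000 : ℝ) := by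
  have := hb.upper x
  rw [hx] at this
  exact ⟨hb.second, this.trans_eq (by ring)⟩

lemma grad_smul (b : Fin m → EuclideanSpace ℂ (Fin n)) (x z : EuclideanSpace ℂ (Fin n)) (c : ℝ) :
    grad b (samples b ((c : ℂ) • x)) ((c : ℂ) • z) =
      ((c ^ 3 : ℝ) : ℂ) • grad b (samples b x) z := by
  simp only [grad, samples_smul, Finset.smul_sum]
  refine Finset.sum_congr rfl fun r _ => ?_
  rw [inner_smul_right, norm_mul, Complex.norm_real, mul_pow, Real.norm_eq_abs, sq_abs]
  simp only [smul_smul]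
  congr 1
  push_cast
  ring

/-- The gradient is homogeneous of degree 3 in signal and point jointly, and the division by ‖z₀‖²
removes two degrees. -/
lemma iterate_smul (b : Fin m → EuclideanSpace ℂ (Fin n)) (x z : EuclideanSpace ℂ (Fin n))
    (μ : ℕ → ℝ) {c : ℝ} (hc : 0 < c) (τ : ℕ) :
    iterate b (samples b ((c : ℂ) • x)) μ ((c : ℂ) • z) τ =
      (c : ℂ) • iterate b (samples b x) μ z τ := by
  induction τ with
  | zero => rfl
  | succ τ ih =>
    rw [iterate, iterate, ih, grad_smul, smul_sub, smul_smul, smul_smul, norm_smul,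
      Complex.norm_real, Real.norm_of_nonneg hc.le]
    congr 2
    rw [← Complex.ofReal_mul, ← Complex.ofReal_mul]
    congr 1
    -- For z = 0 both step lengths are zero, division by zero being zero.
    by_cases hz : ‖z‖ = 0
    · simp [hz]
    · field_simp

/-- Geometric convergence of Wirtinger flow for a nonzero signal. -/
lemma WellConditioned.phaseDist_iterate_smul_le {b : Fin m → EuclideanSpace ℂ (Fin n)}
    {x : EuclideanSpace ℂ (Fin n)} (hb : WellConditioned b x) (hx : ‖x‖ = 1) (hn : 0 < n)
    (hm : 0 < m) {μ : ℝ} (hμ : 0 < μ) (hμn : μ ≤ 1 / 10000 / n) {c : ℝ} (hc : 0 < c)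
    {z₀ : EuclideanSpace ℂ (Fin n)} (hz₀ : phaseDist z₀ ((c : ℂ) • x) ≤ 1 / 8 * ‖(c : ℂ) • x‖)
    (τ : ℕ) :
    phaseDist (iterate b (samples b ((c : ℂ) • x)) (fun _ => μ) z₀ τ) ((c : ℂ) • x) ≤
      1 / 8 * (1 - μ / 4) ^ ((τ : ℝ) / 2) * ‖(c : ℂ) • x‖ := by
  have hcc : (c : ℂ) * ((c⁻¹ : ℝ) : ℂ) = 1 := by
    rw [← Complex.ofReal_mul, mul_inv_cancel₀ hc.ne', Complex.ofReal_one]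
  have hcc' : ((c⁻¹ : ℝ) : ℂ) * (c : ℂ) = 1 := by rw [mul_comm, hcc]
  have hnorm : ‖(c : ℂ) • x‖ = c := by
    rw [norm_smul, hx, Complex.norm_real, Real.norm_of_nonneg hc.le, mul_one]
  have h1 := phaseDist_smul_smul_le (inv_nonneg.2 hc.le) z₀ ((c : ℂ) • x)
  rw [smul_smul, hcc', one_smul] at h1
  rw [hnorm] at hz₀ ⊢
  have h2 : phaseDist (((c⁻¹ : ℝ) : ℂ) • z₀) x ≤ 1 / 8 := by
    refine h1.trans ?_
    rw [inv_mul_le_iff₀ hc]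
    linarith
  have h3 := hb.phaseDist_iterate_le hx hn hm hμ hμn h2 τ
  have e : z₀ = (c : ℂ) • (((c⁻¹ : ℝ) : ℂ) • z₀) := by rw [smul_smul, hcc, one_smul]
  rw [e, iterate_smul b x _ _ hc]
  refine (phaseDist_smul_smul_le hc.le _ _).trans ?_
  rw [mul_comm]
  gcongr

lemma phaseDist_zero_zero_le : phaseDist (0 : EuclideanSpace ℂ (Fin n)) 0 ≤ 0 := by
  simpa using phaseDist_le_norm_sub_smul (0 : EuclideanSpace ℂ (Fin n)) 0 (ζ := 1) (by simp)

lemma samples_zero (b : Fin m → EuclideanSpace ℂ (Fin n)) : samples b 0 = 0 := by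
  ext r; simp [samples]

lemma IsSpectralInit.eq_zero {b : Fin m → EuclideanSpace ℂ (Fin n)} {y : Fin m → ℝ} {s : ℝ}
    {z₀ : EuclideanSpace ℂ (Fin n)} (h : IsSpectralInit b y s z₀) (hs : s = 0) : z₀ = 0 := by
  obtain ⟨t, v, -, -, -, rfl⟩ := h
  simp [hs]

lemma iterate_zero (b : Fin m → EuclideanSpace ℂ (Fin n)) (y : Fin m → ℝ) (μ : ℕ → ℝ) (τ : ℕ) :
    iterate b y μ 0 τ = 0 := by
  induction τ with
  | zero => rfl
  | succ τ ih => rw [iterate, ih]; simp [grad]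

end Initialization

end WirtingerFlow

/-! ### The main theorem -/

theorem theorem1 :
    ∃ c₀ γ c₁ : ℝ, 0 < c₀ ∧ 0 < γ ∧ 0 < c₁ ∧
      ∀ (n m : ℕ), c₀ * n * Real.log n ≤ m →
      ∀ (Ω : Type*) [MeasurableSpace Ω] (P : Measure Ω) [IsProbabilityMeasure P]
        (a : Fin m → Ω → EuclideanSpace ℂ (Fin n)), WirtingerFlow.IsGaussianModel P a →
      ∀ x : EuclideanSpace ℂ (Fin n),
        -- the initial estimate, normalized to squared norm `(1/m) ∑ y_r`
        (∃ E : Set Ω, MeasurableSet E ∧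
          1 - 10 * Real.exp (-γ * n) - 8 / (n : ℝ) ^ 2 ≤ P.real E ∧
          ∀ ω ∈ E, ∀ z₀ : EuclideanSpace ℂ (Fin n),
            WirtingerFlow.IsSpectralInit (fun r => a r ω)
              (WirtingerFlow.samples (fun r => a r ω) x)
              (Real.sqrt ((1 / (m : ℝ)) * ∑ r, WirtingerFlow.samples (fun r => a r ω) x r)) z₀ →
            WirtingerFlow.phaseDist z₀ x ≤ 1 / 8 * ‖x‖) ∧
        -- the initial estimate, normalized to squared norm `n (∑ y_r) / (∑ ‖a_r‖²)`
        (∃ E : Set Ω, MeasurableSet E ∧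
          1 - 10 * Real.exp (-γ * n) - 8 / (n : ℝ) ^ 2 ≤ P.real E ∧
          ∀ ω ∈ E, ∀ z₀ : EuclideanSpace ℂ (Fin n),
            WirtingerFlow.IsSpectralInit (fun r => a r ω)
              (WirtingerFlow.samples (fun r => a r ω) x)
              (Real.sqrt (n * ((∑ r, WirtingerFlow.samples (fun r => a r ω) x r) /
                ∑ r, ‖a r ω‖ ^ 2))) z₀ →
            WirtingerFlow.phaseDist z₀ x ≤ 1 / 8 * ‖x‖) ∧
        -- geometric convergence with a constant learning parameter
        (∀ μ : ℝ, 0 < μ → μ ≤ c₁ / n →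
          ∃ E : Set Ω, MeasurableSet E ∧
            1 - 13 * Real.exp (-γ * n) - m * Real.exp (-(1.5 * m)) - 8 / (n : ℝ) ^ 2 ≤ P.real E ∧
            ∀ ω ∈ E, ∀ z₀ : EuclideanSpace ℂ (Fin n),
              WirtingerFlow.phaseDist z₀ x ≤ 1 / 8 * ‖x‖ →
              ∀ τ : ℕ,
                WirtingerFlow.phaseDist
                  (WirtingerFlow.iterate (fun r => a r ω)
                    (WirtingerFlow.samples (fun r => a r ω) x) (fun _ => μ) z₀ τ) x ≤
                1 / 8 * (1 - μ / 4) ^ ((τ : ℝ) / 2) * ‖x‖) := by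
  refine ⟨10 ^ 15, 1 / 10 ^ 6, 1 / 10000, by norm_num, by norm_num, by norm_num, ?_⟩
  intro n m hm Ω _ P _ a ha x
  -- For small n, 10 e^{-γn} ≥ 10/e > 1, so the required probability is negative.
  rcases lt_or_ge n (10 ^ 6) with hn | hn
  · have hexp : 1 / 3 ≤ Real.exp (-(1 / 10 ^ 6) * (n : ℝ)) := by
      have hn' : (n : ℝ) ≤ 10 ^ 6 := by exact_mod_cast hn.le
      have h1 : Real.exp (-1) ≤ Real.exp (-(1 / 10 ^ 6) * (n : ℝ)) :=
        Real.exp_le_exp.2 (by linarith)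
      have h2 : (3 : ℝ)⁻¹ ≤ Real.exp (-1) := by
        rw [Real.exp_neg]
        exact inv_anti₀ (Real.exp_pos 1) (by linarith [Real.exp_one_lt_d9])
      linarith
    have hn2 : 0 ≤ 8 / (n : ℝ) ^ 2 := by positivity
    have hm2 : 0 ≤ (m : ℝ) * Real.exp (-(1.5 * m)) := by positivity
    have hP : P.real ∅ = 0 := by simp
    refine ⟨⟨∅, MeasurableSet.empty, by rw [hP]; linarith, fun ω hω => hω.elim⟩,
      ⟨∅, MeasurableSet.empty, by rw [hP]; linarith, fun ω hω => hω.elim⟩,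
      fun μ _ _ => ⟨∅, MeasurableSet.empty, by rw [hP]; linarith, fun ω hω => hω.elim⟩⟩
  have hn' : (10 : ℝ) ^ 6 ≤ n := by exact_mod_cast hn
  have hn0 : (0 : ℝ) < n := by linarith
  have hexp : Real.exp (-(n : ℝ)) ≤ Real.exp (-(1 / 10 ^ 6) * (n : ℝ)) :=
    Real.exp_le_exp.2 (by linarith)
  have hexp0 : 0 < Real.exp (-(n : ℝ)) := Real.exp_pos _
  have hn2 : 1 / (n : ℝ) ^ 2 ≤ 8 / (n : ℝ) ^ 2 := by gcongr; norm_num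
  have hn2' : 0 ≤ 1 / (n : ℝ) ^ 2 := by positivity
  have hm2 : 0 ≤ (m : ℝ) * Real.exp (-(1.5 * m)) := by positivity
  have hlog : 0 < Real.log n := Real.log_pos (by linarith)
  have hm0 : 0 < m := by
    have : (0 : ℝ) < m := lt_of_lt_of_le (by positivity) hm
    exact_mod_cast this
  have hm0' : (0 : ℝ) < m := by exact_mod_cast hm0
  by_cases hx : x = 0
  · subst hx
    have hP : P.real Set.univ = 1 := by simp
    simp only [WirtingerFlow.samples_zero, norm_zero, mul_zero]
    refine ⟨⟨Set.univ, MeasurableSet.univ, by rw [hP]; linarith, fun ω _ z₀ hz => ?_⟩,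
      ⟨Set.univ, MeasurableSet.univ, by rw [hP]; linarith, fun ω _ z₀ hz => ?_⟩,
      fun μ _ _ => ⟨Set.univ, MeasurableSet.univ, by rw [hP]; linarith,
        fun ω _ z₀ hz τ => ?_⟩⟩
    · rw [hz.eq_zero (by simp)]
      exact WirtingerFlow.phaseDist_zero_zero_le
    · rw [hz.eq_zero (by simp)]
      exact WirtingerFlow.phaseDist_zero_zero_le
    -- For zero signal the hypothesis forces z₀ = 0, a point where the gradient vanishes.
    · obtain ⟨ζ, -, -, hd⟩ := WirtingerFlow.exists_phaseDist_eq z₀ 0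
      rw [← hd, smul_zero, sub_zero, norm_le_zero_iff] at hz
      rw [hz, WirtingerFlow.iterate_zero]
      exact WirtingerFlow.phaseDist_zero_zero_le
  obtain ⟨u, hu, hxu⟩ := WirtingerFlow.exists_unit_smul hx
  obtain ⟨c, hc, hxc⟩ : ∃ c : ℝ, 0 < c ∧ x = (c : ℂ) • u := ⟨‖x‖, norm_pos_iff.2 hx, hxu⟩
  clear hxu
  subst hxc
  obtain ⟨E, hE, hPE, hW⟩ := ha.exists_wellConditioned hn hm hu
  refine ⟨⟨E, hE, by linarith, fun ω hω z₀ hz => ?_⟩, ⟨E, hE, by linarith, fun ω hω z₀ hz => ?_⟩,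
    fun μ hμ hμn => ⟨E, hE, by linarith, fun ω hω z₀ hz τ =>
      (hW ω hω).phaseDist_iterate_smul_le hu (by omega) hm0 hμ hμn hc hz τ⟩⟩
  · obtain ⟨h1, h2⟩ := (hW ω hω).mean_samples hu
    refine (hW ω hω).phaseDist_spectralInit_le hm0 hu hc
      -- The squared norm of the initial vector for the unit signal u, within 1/1000 of 1; the
      -- actual one is c²q.
      (q := 1 / m * ∑ r, WirtingerFlow.samples (fun r => a r ω) u r) ?_ ?_ ?_ hz
    · simp only [WirtingerFlow.samples_smul, ← Finset.mul_sum]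
      congr 1; ring
    · rw [one_div, le_inv_mul_iff₀ hm0']; linarith
    · rw [one_div, inv_mul_le_iff₀ hm0']; linarith
  · obtain ⟨h1, h2⟩ := (hW ω hω).mean_samples hu
    have h3 := (hW ω hω).energy
    have h4 := (hW ω hω).energy_le
    have hmn : 0 < (m : ℝ) * n := by positivity
    have h5 : 0 < ∑ r, ‖a r ω‖ ^ 2 := lt_of_lt_of_le (by positivity) h3
    refine (hW ω hω).phaseDist_spectralInit_le hm0 hu hc
      (q := n * ((∑ r, WirtingerFlow.samples (fun r => a r ω) u r) / ∑ r, ‖a r ω‖ ^ 2)) ?_ ?_ ?_ hz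
    · simp only [WirtingerFlow.samples_smul, ← Finset.mul_sum]
      congr 1; ring
    · rw [← mul_div_assoc, le_div_iff₀ h5]
      have := mul_le_mul_of_nonneg_left h1 hn0.le
      linarith
    · rw [← mul_div_assoc, div_le_iff₀ h5]
      have := mul_le_mul_of_nonneg_left h2 hn0.le
      linarith
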